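/- Let $(X,d,\mu)$ be a space of homogeneous type: $d$ is a quasi-metric on $X$ with $d(x,y)\le A_0(d(x,z)+d(z,y))$, $A_0\ge 1$; $X$ carries the topology in which $U$ is open iff every $x\in U$ has a ball $B(x,r)=\{y: d(x,y)<r\}\subset U$; all balls are Borel sets; and $\mu$ is a Borel measure with $0<\mu(B(x,2r))\le A_1\mu(B(x,r))<\infty$ for all $x\in X$, $r>0$. Assume $\mu(X)=\infty$ and $\mu(\{x\})=0$ for every $x\in X$. Let $C_\mu$ be the smallest admissible $A_1$ and $\mathbb Q=\log_2 C_\mu$. Let $\omega\colon[0,1]\to[0,\infty)$ be continuous, increasing and subadditive with $\omega(0)=0$ and $\int_0^1\omega(t)\,\frac{dt}{t}<\infty$. Let $K$ be an $\omega$-Calderón–Zygmund kernel: with $V(x,y)=\mu(B(x,d(x,y)))$, $|K(x,y)|\le c_K/V(x,y)$ for $x\ne y$, and $$|K(x,y)-K(x',y)|+|K(y,x)-K(y,x')|\le \frac{1}{V(x,y)}\,\omega\Big(\frac{d(x,x')}{d(x,y)}\Big)\quad\text{if } d(x,x')<(2A_0)^{-1}d(x,y).$$ Suppose $K$ is non-degenerate: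 there are $c_0,\bar C>0$ such that for all $x\in X$, $r>0$ there is $y\in B(x,\bar Cr)\setminus B(x,r)$ with $|K(x,y)|\ge \frac{1}{c_0\mu(B(x,r))}$. Let $T$ be a bounded linear operator on $L^2(X)$ such that, for every $f\in L^2(X)$, $Tf(x)=\int_X K(x,y)f(y)\,d\mu(y)$ for almost every $x\notin\operatorname{supp} f$; denote also by $T$ its bounded continuation $L^1(X)\to L^{1,\infty}(X)$. Let $1<p\le q<\infty$ and $\frac{\alpha}{\mathbb Q}=\frac1p-\frac1q$. Write $\|f\|_{L^p_w}=(\int_X|fw|^p\,d\mu)^{1/p}$, $w(B)=\int_B w\,d\mu$, $$[w]_{A_p}=\sup_B\frac{\big(\int_B w\,d\mu\big)\big(\int_B w^{-1/(p-1)}\,d\mu\big)^{p-1}}{\mu(B)^p},\qquad [w]_{A_{p,p}}=[w^p]_{A_p}^{1/p},$$ and $w\in A_{p,p}$ if $w\colon X\to(0,\infty)$ and $w^p$ are integrable on balls and $[w]_{A_{p,p}}<\infty$. Let $\lambda_1\in A_{p,p}$, $\lambda_2\in A_{q,q}$, and $\nu=(\lambda_1/\lambda_2)^{1/(1/p+1/q')}$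 with $\frac1q+\frac1{q'}=1$. Let $b\colon X\to\mathbb C$ be measurable and integrable on every ball, and let $[b,T]f=bTf-T(bf)$ for $f$ in the space $L^\infty_{\rm bs}(X)$ of bounded measurable functions with bounded support. If $[b,T]$ is bounded from $L^p_{\lambda_1}(X)$ to $L^q_{\lambda_2}(X)$, that is, if $\|[b,T]f\|_{L^q_{\lambda_2}}\le\Theta\|f\|_{L^p_{\lambda_1}}$ for some $\Theta<\infty$ and all $f\in L^\infty_{\rm bs}(X)$, with $\|[b,T]\|$ the infimum of such $\Theta$, then $b\in \mathrm{BMO}^\alpha_\nu(X)$ and $$\|b\|_{\mathrm{BMO}^\alpha_\nu(X)}:=\sup_B\frac{1}{\nu(B)^{\alpha/\mathbb Q}}\bigg(\frac{1}{\nu(B)}\int_B|b-\langle b\rangle_B|\,d\mu\bigg)\le C\,\|[b,T]\|,\qquad \langle b\rangle_B=\frac1{\mu(B)}\int_B b\,d\mu,$$ where the suprema are over all balls and the constant $C>0$ depends only on $A_0$, $A_1$, $c_K$, $\omega$, $c_0$, $\bar C$, $p$, $q$ and on upper bounds for $[\lambda_1]_{A_{p,p}}$ and $[\lambda_2]_{A_{q,q}}$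 (in particular not on $b$). -/

import Mathlib

open MeasureTheory Filter Topology
open scoped NNReal ENNReal

namespace FracBloom

noncomputable section

variable {X : Type*}

/-! ### Spaces of homogeneous type -/

/-- The ball `B(x, r) = {y : d x y < r}` of a quasi-metric `d`. -/
def qball (d : X → X → ℝ) (x : X) (r : ℝ) : Set X := {y | d x y < r}

/-- `(X, d, μ)` is a space of homogeneous type with quasi-triangle constant `A₀` and doubling
constant `A₁`, with `μ(X) = ∞` and without atoms. The topology of `X` is the one induced by `d`,
and `μ` is a measure on its Borel sets, which include all balls. -/
structure IsHomogeneousType [TopologicalSpace X] [MeasurableSpace X] [BorelSpace X]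
    (d : X → X → ℝ) (μ : Measure X) (A₀ A₁ : ℝ) : Prop where
  dist_symm : ∀ x y, d x y = d y x
  dist_nonneg : ∀ x y, 0 ≤ d x y
  dist_eq_zero : ∀ x y, d x y = 0 ↔ x = y
  one_le_quasi : 1 ≤ A₀
  quasi_triangle : ∀ x y z, d x y ≤ A₀ * (d x z + d z y)
  isOpen_iff : ∀ U : Set X, IsOpen U ↔ ∀ x ∈ U, ∃ r > 0, qball d x r ⊆ U
  measurableSet_ball : ∀ x r, MeasurableSet (qball d x r)
  one_le_doubling : 1 ≤ A₁
  ball_pos : ∀ x, ∀ r > 0, 0 < μ (qball d x (2 * r))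
  doubling : ∀ x, ∀ r > 0, μ (qball d x (2 * r)) ≤ ENNReal.ofReal A₁ * μ (qball d x r)
  ball_lt_top : ∀ x, ∀ r > 0, μ (qball d x r) < ∞
  measure_univ : μ Set.univ = ∞
  measure_singleton : ∀ x, μ {x} = 0

/-- The smallest doubling constant `C_μ` of `μ`. -/
def doublingConst [MeasurableSpace X] (d : X → X → ℝ) (μ : Measure X) : ℝ :=
  sInf {A : ℝ | 1 ≤ A ∧ ∀ x, ∀ r > 0, μ (qball d x (2 * r)) ≤ ENNReal.ofReal A * μ (qball d x r)}

/-- The upper dimension `ℚ = log₂ C_μ` of `μ`. -/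
def upperDim [MeasurableSpace X] (d : X → X → ℝ) (μ : Measure X) : ℝ :=
  Real.logb 2 (doublingConst d μ)

/-! ### Function classes -/

/-- `b ∈ L¹_loc(X)`: measurable and integrable on every ball. -/
def MemL1loc [MeasurableSpace X] (d : X → X → ℝ) (μ : Measure X) (b : X → ℂ) : Prop :=
  Measurable b ∧ ∀ x, ∀ r > 0, IntegrableOn b (qball d x r) μ

/-- `f ∈ L^∞_bs(X)`: measurable, bounded, and with bounded support. -/
def MemLinftyBs [TopologicalSpace X] [MeasurableSpace X] (d : X → X → ℝ) (f : X → ℂ) : Prop :=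
  Measurable f ∧ (∃ M : ℝ, ∀ x, ‖f x‖ ≤ M) ∧ ∃ x, ∃ r > 0, tsupport f ⊆ qball d x r

/-- The weighted norm `‖f‖_{L^p_w} = (∫ |f w|^p dμ)^{1/p}`. -/
def wnorm [MeasurableSpace X] (μ : Measure X) (p : ℝ) (w : X → ℝ) (f : X → ℂ) : ℝ≥0∞ :=
  eLpNorm (fun x => f x * (w x : ℂ)) (ENNReal.ofReal p) μ

/-! ### Weights -/

/-- `w(E) = ∫_E w dμ`. -/
def wmeas [MeasurableSpace X] (μ : Measure X) (w : X → ℝ) (E : Set X) : ℝ≥0∞ :=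
  ∫⁻ x in E, ENNReal.ofReal (w x) ∂μ

/-- A weight: a locally integrable function `w : X → (0, ∞)`. -/
def IsWeight [MeasurableSpace X] (d : X → X → ℝ) (μ : Measure X) (w : X → ℝ) : Prop :=
  Measurable w ∧ (∀ x, 0 < w x) ∧ ∀ x, ∀ r > 0, IntegrableOn w (qball d x r) μ

/-- The Muckenhoupt characteristic
`[w]_{A_p} = sup_B w(B) (∫_B w^{-1/(p-1)} dμ)^{p-1} / μ(B)^p`. -/
def apConst [MeasurableSpace X] (d : X → X → ℝ) (μ : Measure X) (p : ℝ) (w : X → ℝ) : ℝ≥0∞ :=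
  ⨆ (x : X) (r : ℝ) (_ : 0 < r),
    wmeas μ w (qball d x r) *
      (wmeas μ (fun y => w y ^ (-(1 / (p - 1)))) (qball d x r)) ^ (p - 1) /
        μ (qball d x r) ^ p

/-- `w ∈ A_p`. -/
def IsAp [MeasurableSpace X] (d : X → X → ℝ) (μ : Measure X) (p : ℝ) (w : X → ℝ) : Prop :=
  IsWeight d μ w ∧ apConst d μ p w < ∞

/-- `w ∈ A_{p,p}`, that is, `w^p ∈ A_p`. -/
def IsApp [MeasurableSpace X] (d : X → X → ℝ) (μ : Measure X) (p : ℝ) (w : X → ℝ) : Prop :=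
  IsWeight d μ w ∧ IsAp d μ p (fun x => w x ^ p)

/-- `[w]_{A_{p,p}} = [w^p]_{A_p}^{1/p}`. -/
def appConst [MeasurableSpace X] (d : X → X → ℝ) (μ : Measure X) (p : ℝ) (w : X → ℝ) : ℝ≥0∞ :=
  apConst d μ p (fun x => w x ^ p) ^ (1 / p)

/-- The fractional Bloom weight `ν = (w₁ / w₂)^{1 / (1/p + 1/q')}`. -/
def bloomWeight (p q : ℝ) (w₁ w₂ : X → ℝ) : X → ℝ :=
  fun x => (w₁ x / w₂ x) ^ (1 / (1 / p + 1 / q.conjExponent))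

/-! ### Weighted fractional BMO -/

/-- `‖b‖_{BMO_w^α} = sup_B w(B)^{-α/ℚ} w(B)^{-1} ∫_B |b - ⟨b⟩_B| dμ`. -/
def bmoNorm [MeasurableSpace X] (d : X → X → ℝ) (μ : Measure X) (α : ℝ) (w : X → ℝ)
    (b : X → ℂ) : ℝ≥0∞ :=
  ⨆ (x : X) (r : ℝ) (_ : 0 < r),
    ((wmeas μ w (qball d x r)) ^ (α / upperDim d μ))⁻¹ *
      ((wmeas μ w (qball d x r))⁻¹ *
        ∫⁻ y in qball d x r, ‖b y - ⨍ z in qball d x r, b z ∂μ‖ₑ ∂μ)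

/-- `b ∈ BMO_w^α(X)`. -/
def MemBMO [MeasurableSpace X] (d : X → X → ℝ) (μ : Measure X) (α : ℝ) (w : X → ℝ)
    (b : X → ℂ) : Prop :=
  MemL1loc d μ b ∧ bmoNorm d μ α w b < ∞

/-! ### Calderón–Zygmund kernels and operators -/

/-- `ω : [0,1] → [0,∞)` is continuous, increasing and subadditive, with `ω(0) = 0`. -/
structure IsModulus (ω : ℝ → ℝ) : Prop where
  nonneg : ∀ t ∈ Set.Icc (0 : ℝ) 1, 0 ≤ ω t
  continuousOn : ContinuousOn ω (Set.Icc 0 1)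
  monotoneOn : MonotoneOn ω (Set.Icc 0 1)
  subadditive : ∀ s t, 0 ≤ s → 0 ≤ t → s + t ≤ 1 → ω (s + t) ≤ ω s + ω t
  zero : ω 0 = 0

/-- The Dini condition `∫₀¹ ω(t) dt / t < ∞`. -/
def IsDini (ω : ℝ → ℝ) : Prop :=
  ∫⁻ t in Set.Ioc (0 : ℝ) 1, ENNReal.ofReal (ω t / t) < ∞

/-- `V(x, y) = μ(B(x, d(x, y)))`. -/
def vol [MeasurableSpace X] (d : X → X → ℝ) (μ : Measure X) (x y : X) : ℝ :=
  μ.real (qball d x (d x y))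

/-- `K` is an `ω`-Calderón–Zygmund kernel with size constant `cK`. The values of `K` on the
diagonal play no role. -/
structure IsCZKernel [MeasurableSpace X] (d : X → X → ℝ) (μ : Measure X) (A₀ cK : ℝ)
    (ω : ℝ → ℝ) (K : X → X → ℂ) : Prop where
  size : ∀ x y, x ≠ y → ‖K x y‖ ≤ cK / vol d μ x y
  regularity : ∀ x x' y, d x x' < (2 * A₀)⁻¹ * d x y →
    ‖K x y - K x' y‖ + ‖K y x - K y x'‖ ≤ 1 / vol d μ x y * ω (d x x' / d x y)

/-- Non-degeneracy of `K` with constants `c₀` and `Cbar`. -/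
def IsNondegenerate [MeasurableSpace X] (d : X → X → ℝ) (μ : Measure X) (c₀ Cbar : ℝ)
    (K : X → X → ℂ) : Prop :=
  0 < c₀ ∧ 0 < Cbar ∧ ∀ x, ∀ r > 0, ∃ y ∈ qball d x (Cbar * r) \ qball d x r,
    1 / (c₀ * μ.real (qball d x r)) ≤ ‖K x y‖

/-- The value `T f` of an operator `T` on `L²` at a function `f` (`0` if `f ∉ L²`). -/
def applyL2 [MeasurableSpace X] {μ : Measure X} (T : Lp ℂ 2 μ →L[ℂ] Lp ℂ 2 μ) (f : X → ℂ) :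
    X → ℂ :=
  open Classical in if h : MemLp f 2 μ then (T (h.toLp f) : X → ℂ) else 0

/-- The bounded operator `T` on `L²` has the kernel `K`: for every `f ∈ L²`,
`T f (x) = ∫ K(x, y) f(y) dμ(y)` for (almost) every `x ∉ supp f`. -/
def HasKernel [TopologicalSpace X] [MeasurableSpace X] {μ : Measure X}
    (T : Lp ℂ 2 μ →L[ℂ] Lp ℂ 2 μ) (K : X → X → ℂ) : Prop :=
  ∀ f : X → ℂ, Measurable f → MemLp f 2 μ →
    ∀ᵐ x ∂μ, x ∉ tsupport f → applyL2 T f x = ∫ y, K x y * f y ∂μ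

/-! ### The continuation of `T` to `L¹` and the commutator -/

/-- The truncation `h · 1_{|h| ≤ n}`. -/
def trunc (h : X → ℂ) (n : ℕ) : X → ℂ :=
  open Classical in fun x => if ‖h x‖ ≤ n then h x else 0

/-- The first level `n` at which the truncation is within `4^{-k}` of `h` in `L¹`. -/
def truncLevel [MeasurableSpace X] (μ : Measure X) (h : X → ℂ) (k : ℕ) : ℕ :=
  sInf {n : ℕ | eLpNorm (h - trunc h n) 1 μ ≤ (4 : ℝ≥0∞)⁻¹ ^ k}

/-- The continuation of `T` from `L¹ ∩ L²` to `L¹`: the almost everywhere limit of `T h_k`, where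
the truncations `h_k ∈ L¹ ∩ L²` of `h ∈ L¹` satisfy `‖h - h_k‖₁ ≤ 4^{-k}`. By
`IsWeakExtension.ae_eq_applyL1` below, this is the bounded continuation `L¹ → L^{1,∞}`. -/
def applyL1 [MeasurableSpace X] {μ : Measure X} (T : Lp ℂ 2 μ →L[ℂ] Lp ℂ 2 μ) (h : X → ℂ) :
    X → ℂ :=
  fun x => limUnder atTop (fun k : ℕ => applyL2 T (trunc h (truncLevel μ h k)) x)

/-- The commutator `[b, T] f = b T f - T (b f)`, for `f ∈ L^∞_bs` and `b ∈ L¹_loc`. -/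
def commutator [MeasurableSpace X] {μ : Measure X} (b : X → ℂ)
    (T : Lp ℂ 2 μ →L[ℂ] Lp ℂ 2 μ) (f : X → ℂ) : X → ℂ :=
  fun x => b x * applyL2 T f x - applyL1 T (fun y => b y * f y) x

/-- `‖[b, T] f‖_{L^q_{w₂}} ≤ Θ ‖f‖_{L^p_{w₁}}` for all `f` in the dense subspace `L^∞_bs`. -/
def CommutatorBound [TopologicalSpace X] [MeasurableSpace X] (d : X → X → ℝ) {μ : Measure X}
    (p q : ℝ) (w₁ w₂ : X → ℝ) (b : X → ℂ) (T : Lp ℂ 2 μ →L[ℂ] Lp ℂ 2 μ) (Θ : ℝ≥0) : Prop :=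
  ∀ f : X → ℂ, MemLinftyBs d f → wnorm μ q w₂ (commutator b T f) ≤ Θ * wnorm μ p w₁ f

/-- The operator norm `‖[b, T]‖_{L^p_{w₁} → L^q_{w₂}}` (`∞` if `[b, T]` is unbounded). -/
def commutatorNorm [TopologicalSpace X] [MeasurableSpace X] (d : X → X → ℝ) {μ : Measure X}
    (p q : ℝ) (w₁ w₂ : X → ℝ) (b : X → ℂ) (T : Lp ℂ 2 μ →L[ℂ] Lp ℂ 2 μ) : ℝ≥0∞ :=
  ⨅ (Θ : ℝ≥0) (_ : CommutatorBound d p q w₁ w₂ b T Θ), (Θ : ℝ≥0∞)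

/-- A bounded linear continuation `S : L¹ → L^{1,∞}` of `T`. -/
structure IsWeakExtension [MeasurableSpace X] {μ : Measure X} (T : Lp ℂ 2 μ →L[ℂ] Lp ℂ 2 μ)
    (S : Lp ℂ 1 μ →ₗ[ℂ] (X →ₘ[μ] ℂ)) : Prop where
  weak_type : ∃ C : ℝ≥0, ∀ (h : Lp ℂ 1 μ) (t : ℝ≥0), 0 < t →
    t * μ {x | (t : ℝ≥0∞) < ‖S h x‖ₑ} ≤ C * ‖h‖ₑ
  agree : ∀ (f : X → ℂ) (h₁ : MemLp f 1 μ), MemLp f 2 μ → S (h₁.toLp f) =ᵐ[μ] applyL2 T f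

theorem measurable_trunc [MeasurableSpace X] {h : X → ℂ} (hh : Measurable h) (n : ℕ) :
    Measurable (trunc h n) := by
  classical
  unfold trunc
  exact Measurable.ite (measurableSet_le hh.norm measurable_const) hh measurable_const

theorem norm_trunc_le (h : X → ℂ) (n : ℕ) (x : X) : ‖trunc h n x‖ ≤ ‖h x‖ := by
  unfold trunc
  split_ifs <;> simp

theorem memLp_trunc [MeasurableSpace X] {μ : Measure X} {h : X → ℂ} (hh : Measurable h)
    (h1 : MemLp h 1 μ) (n : ℕ) : MemLp (trunc h n) 1 μ ∧ MemLp (trunc h n) 2 μ := by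
  have h1' : MemLp (trunc h n) 1 μ :=
    h1.mono (measurable_trunc hh n).aestronglyMeasurable (.of_forall (norm_trunc_le h n))
  refine ⟨h1', ?_⟩
  have hb : ∀ x, ‖trunc h n x‖ ≤ n := by
    intro x
    unfold trunc
    split_ifs with hx
    · exact hx
    · simp
  rw [memLp_two_iff_integrable_sq_norm h1'.aestronglyMeasurable]
  have hi : Integrable (fun x => (n : ℝ) * ‖trunc h n x‖) μ :=
    ((memLp_one_iff_integrable.mp h1').norm).const_mul _
  refine hi.mono ((measurable_trunc hh n).norm.pow_const 2).aestronglyMeasurable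
    (.of_forall fun x => ?_)
  have h0 := norm_nonneg (trunc h n x)
  rw [Real.norm_of_nonneg (by positivity), Real.norm_of_nonneg (by positivity)]
  nlinarith [hb x]

theorem truncLevel_spec [MeasurableSpace X] {μ : Measure X} {h : X → ℂ} (hh : Measurable h)
    (h1 : MemLp h 1 μ) (k : ℕ) :
    eLpNorm (h - trunc h (truncLevel μ h k)) 1 μ ≤ (4 : ℝ≥0∞)⁻¹ ^ k := by
  have hlim : Tendsto (fun n : ℕ => eLpNorm (h - trunc h n) 1 μ) atTop (𝓝 0) := by
    simp only [eLpNorm_one_eq_lintegral_enorm]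
    have := tendsto_lintegral_of_dominated_convergence (μ := μ)
      (F := fun n x => ‖(h - trunc h n) x‖ₑ) (f := fun _ => 0) (fun x => ‖h x‖ₑ)
      (fun n => (hh.sub (measurable_trunc hh n)).enorm) ?_ ?_ ?_
    · simpa using this
    · intro n
      refine .of_forall fun x => ?_
      simp only [Pi.sub_apply, trunc]
      split_ifs <;> simp
    · rw [← eLpNorm_one_eq_lintegral_enorm]
      exact h1.2.ne
    · refine .of_forall fun x => ?_
      refine tendsto_const_nhds.congr' ?_
      obtain ⟨N, hN⟩ := exists_nat_ge ‖h x‖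
      filter_upwards [eventually_ge_atTop N] with n hn
      have : ‖h x‖ ≤ n := hN.trans (by exact_mod_cast hn)
      simp [trunc, this]
  have hne : {n : ℕ | eLpNorm (h - trunc h n) 1 μ ≤ (4 : ℝ≥0∞)⁻¹ ^ k}.Nonempty := by
    have hpos : (0 : ℝ≥0∞) < (4 : ℝ≥0∞)⁻¹ ^ k := by
      apply ENNReal.pow_pos
      simp
    exact (hlim.eventually (eventually_le_nhds hpos)).exists
  exact Nat.sInf_mem hne

/-- Every bounded continuation `L¹ → L^{1,∞}` of `T` is given by `applyL1 T`. -/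
theorem IsWeakExtension.ae_eq_applyL1 [MeasurableSpace X] {μ : Measure X}
    {T : Lp ℂ 2 μ →L[ℂ] Lp ℂ 2 μ} {S : Lp ℂ 1 μ →ₗ[ℂ] (X →ₘ[μ] ℂ)} (hS : IsWeakExtension T S)
    {h : X → ℂ} (hh : Measurable h) (h1 : MemLp h 1 μ) :
    S (h1.toLp h) =ᵐ[μ] applyL1 T h := by
  obtain ⟨C, hC⟩ := hS.weak_type
  set u : ℕ → X → ℂ := fun k => trunc h (truncLevel μ h k) with hu
  have hu1 : ∀ k, MemLp (u k) 1 μ := fun k => (memLp_trunc hh h1 _).1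
  have hu2 : ∀ k, MemLp (u k) 2 μ := fun k => (memLp_trunc hh h1 _).2
  let E : ℕ → Set X := fun k =>
    {x | (((2 : ℝ≥0)⁻¹ ^ k : ℝ≥0) : ℝ≥0∞) < ‖S ((h1.sub (hu1 k)).toLp _) x‖ₑ}
  have hE : ∀ k, μ (E k) ≤ C * (2 : ℝ≥0∞)⁻¹ ^ k := by
    intro k
    have h3 := hC ((h1.sub (hu1 k)).toLp _) ((2 : ℝ≥0)⁻¹ ^ k) (by positivity)
    rw [Lp.enorm_toLp] at h3
    have h4 := h3.trans (mul_le_mul_right (truncLevel_spec hh h1 k) _)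
    have h5 : ((((2 : ℝ≥0)⁻¹ ^ k : ℝ≥0)) : ℝ≥0∞) = (2 : ℝ≥0∞)⁻¹ ^ k := by
      rw [ENNReal.coe_pow, ENNReal.coe_inv (by norm_num)]
      rfl
    have h6 : (4 : ℝ≥0∞)⁻¹ ^ k = (2 : ℝ≥0∞)⁻¹ ^ k * (2 : ℝ≥0∞)⁻¹ ^ k := by
      rw [← mul_pow, ← ENNReal.mul_inv (by simp) (by simp)]
      norm_num
    change _ * μ (E k) ≤ _ at h4
    rw [h5, h6, mul_left_comm] at h4
    refine (ENNReal.mul_le_mul_iff_right ?_ ?_).mp h4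
    · exact (ENNReal.pow_pos (by simp) k).ne'
    · exact ENNReal.pow_ne_top (by simp)
  have hsum : ∑' k, μ (E k) ≠ ∞ := by
    refine ne_top_of_le_ne_top ?_ (ENNReal.tsum_le_tsum hE)
    rw [ENNReal.tsum_mul_left, ENNReal.tsum_geometric]
    refine ENNReal.mul_ne_top ENNReal.coe_ne_top ?_
    simp [ENNReal.one_sub_inv_two]
  have hsub : ∀ k, S ((h1.sub (hu1 k)).toLp _) =ᵐ[μ]
      fun x => S (h1.toLp h) x - applyL2 T (u k) x := by
    intro k
    rw [MemLp.toLp_sub h1 (hu1 k), map_sub]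
    filter_upwards [AEEqFun.coeFn_sub (S (h1.toLp h)) (S ((hu1 k).toLp (u k))),
      hS.agree (u k) (hu1 k) (hu2 k)] with x hx hx'
    rw [hx, Pi.sub_apply, hx']
  filter_upwards [ae_eventually_notMem hsum, ae_all_iff.mpr hsub] with x hx hx'
  refine (Tendsto.limUnder_eq ?_).symm
  rw [tendsto_iff_norm_sub_tendsto_zero]
  refine squeeze_zero' (.of_forall fun _ => norm_nonneg _) ?_
    (tendsto_pow_atTop_nhds_zero_of_lt_one (r := (2 : ℝ)⁻¹) (by norm_num) (by norm_num))
  filter_upwards [hx] with k hk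
  simp only [E, Set.mem_ofPred_eq, not_lt, hx' k] at hk
  rw [norm_sub_rev]
  have h7 : ‖S (h1.toLp h) x - applyL2 T (u k) x‖₊ ≤ (2 : ℝ≥0)⁻¹ ^ k := by
    exact_mod_cast hk
  exact_mod_cast h7

end

end FracBloom

/-!
For a ball `B = B(x₀, r)`, non-degeneracy provides a ball `B' = B(y₀, r)`, far from `B` but of
comparable measure, on which `|K(x₀, y₀)|` is as large as the size condition allows; if `B'` is far
enough, `K` is nearly constant on `B × B'`. Testing `[b, T]` on functions `f` with `|f| ≤ 1` on `B'`
therefore bounds `∫_B |∫_{B'} (b(x) - b(y)) f(y) dμ(y)| dμ(x)`, up to a small multiple of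
`∫_B ∫_{B'} |b(x) - b(y)|`. The choice `f = 1` controls the oscillation of `b` on `B` around its
average over `B'`, and a unimodular `f` aligned with `b - ⟨b⟩_{B'}` the oscillation on `B'`, so the
error can be absorbed. Hölder's inequality and the two Muckenhoupt conditions turn the norms of
the test functions into `ν(B)^{1/p + 1/q'}`.
-/

namespace FracBloom

noncomputable section

variable {X : Type*}

/-! ### Geometry of spaces of homogeneous type -/

theorem qball_mono (d : X → X → ℝ) (x : X) {r R : ℝ} (hr : r ≤ R) : qball d x r ⊆ qball d x R :=
  fun _ hy => lt_of_lt_of_le hy hr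

/-- The factor `A₁ ^ ⌈log₂ t⌉` by which a measure with doubling constant `A₁` can grow when the
radius of a ball is multiplied by `t`. -/
def growth (A₁ t : ℝ) : ℝ :=
  A₁ ^ ⌈Real.logb 2 t⌉₊

theorem le_two_pow_ceil_logb (t : ℝ) : t ≤ 2 ^ ⌈Real.logb 2 t⌉₊ := by
  rcases le_or_gt t 0 with ht | ht
  · exact ht.trans (by positivity)
  · rw [← Real.rpow_natCast]
    exact (Real.logb_le_iff_le_rpow one_lt_two ht).1 (Nat.le_ceil _)

namespace IsHomogeneousType

variable [TopologicalSpace X] [MeasurableSpace X] [BorelSpace X] {d : X → X → ℝ} {μ : Measure X}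
  {A₀ A₁ : ℝ}

theorem quasi_pos (h : IsHomogeneousType d μ A₀ A₁) : 0 < A₀ :=
  one_pos.trans_le h.one_le_quasi

theorem growth_pos (h : IsHomogeneousType d μ A₀ A₁) (t : ℝ) : 0 < growth A₁ t :=
  pow_pos (one_pos.trans_le h.one_le_doubling) _

theorem mem_qball_self (h : IsHomogeneousType d μ A₀ A₁) (x : X) {r : ℝ} (hr : 0 < r) :
    x ∈ qball d x r := by
  simpa [qball, (h.dist_eq_zero x x).2 rfl] using hr

theorem qball_subset_qball (h : IsHomogeneousType d μ A₀ A₁) {x z : X} {r R : ℝ}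
    (hR : A₀ * (d x z + r) ≤ R) : qball d z r ⊆ qball d x R := fun y (hy : d z y < r) =>
  calc d x y ≤ A₀ * (d x z + d z y) := h.quasi_triangle x y z
    _ < A₀ * (d x z + r) := by have := h.quasi_pos; gcongr
    _ ≤ R := hR

theorem le_two_mul_dist (h : IsHomogeneousType d μ A₀ A₁) {x x' y : X} {r R : ℝ}
    (hr : 2 * A₀ * r ≤ R) (hxy : R ≤ d x y) (hx : d x x' < r) : R ≤ 2 * A₀ * d x' y := by
  have := h.quasi_pos
  have htri : d x y ≤ A₀ * (r + d x' y) := (h.quasi_triangle x y x').trans (by gcongr)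
  linarith

theorem le_dist_of_mem_qball (h : IsHomogeneousType d μ A₀ A₁) {x₀ y₀ x y : X} {r R : ℝ}
    (hr : 4 * A₀ ^ 2 * r ≤ R) (hR : R ≤ d x₀ y₀) (hx : x ∈ qball d x₀ r)
    (hy : y ∈ qball d y₀ r) : r ≤ d x y := by
  have hA₀ := h.quasi_pos
  have hr0 : 0 ≤ r := (h.dist_nonneg x₀ x).trans (le_of_lt hx)
  have hrR : 2 * A₀ * r ≤ R := by nlinarith [h.one_le_quasi, mul_nonneg hA₀.le hr0]
  have hy₀x : R / (2 * A₀) ≤ d y₀ x := by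
    rw [div_le_iff₀' (by positivity), h.dist_symm]
    exact h.le_two_mul_dist hrR hR hx
  have hyx : R / (2 * A₀) ≤ 2 * A₀ * d y x :=
    h.le_two_mul_dist (by rw [le_div_iff₀ (by positivity)]; linarith) hy₀x hy
  rw [div_le_iff₀ (by positivity), h.dist_symm] at hyx
  refine le_of_mul_le_mul_left (a := 4 * A₀ ^ 2) ?_ (by positivity)
  linarith

theorem measure_qball_pos (h : IsHomogeneousType d μ A₀ A₁) (x : X) {r : ℝ} (hr : 0 < r) :
    0 < μ (qball d x r) := by
  simpa [mul_div_cancel₀] using h.ball_pos x (r / 2) (half_pos hr)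

theorem measureReal_qball_pos (h : IsHomogeneousType d μ A₀ A₁) (x : X) {r : ℝ} (hr : 0 < r) :
    0 < μ.real (qball d x r) :=
  ENNReal.toReal_pos (h.measure_qball_pos x hr).ne' (h.ball_lt_top x r hr).ne

theorem measure_qball_two_pow (h : IsHomogeneousType d μ A₀ A₁) (x : X) {r : ℝ} (hr : 0 < r)
    (n : ℕ) : μ (qball d x (2 ^ n * r)) ≤ ENNReal.ofReal A₁ ^ n * μ (qball d x r) := by
  induction n with
  | zero => simp
  | succ n ih =>
    calc μ (qball d x (2 ^ (n + 1) * r)) = μ (qball d x (2 * (2 ^ n * r))) := by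
          rw [pow_succ', mul_assoc]
      _ ≤ ENNReal.ofReal A₁ * μ (qball d x (2 ^ n * r)) := h.doubling x _ (by positivity)
      _ ≤ ENNReal.ofReal A₁ * (ENNReal.ofReal A₁ ^ n * μ (qball d x r)) := by gcongr
      _ = ENNReal.ofReal A₁ ^ (n + 1) * μ (qball d x r) := by rw [pow_succ', mul_assoc]

theorem measure_qball_le_growth_mul (h : IsHomogeneousType d μ A₀ A₁) {x y : X} {r R t : ℝ}
    (hr : 0 < r) (ht : A₀ * (d y x + R) ≤ t * r) :
    μ (qball d x R) ≤ ENNReal.ofReal (growth A₁ t) * μ (qball d y r) := by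
  have hsub : qball d x R ⊆ qball d y (2 ^ ⌈Real.logb 2 t⌉₊ * r) :=
    h.qball_subset_qball (ht.trans (by gcongr; exact le_two_pow_ceil_logb t))
  rw [growth, ENNReal.ofReal_pow (zero_le_one.trans h.one_le_doubling)]
  exact (measure_mono hsub).trans (h.measure_qball_two_pow y hr _)

theorem measureReal_qball_le_growth_mul (h : IsHomogeneousType d μ A₀ A₁) {x y : X}
    {r R t : ℝ} (hr : 0 < r) (ht : A₀ * (d y x + R) ≤ t * r) :
    μ.real (qball d x R) ≤ growth A₁ t * μ.real (qball d y r) := by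
  rw [← ENNReal.toReal_ofReal (h.growth_pos t).le]
  exact (ENNReal.toReal_mono (ENNReal.mul_ne_top ENNReal.ofReal_ne_top (h.ball_lt_top y r hr).ne)
    (h.measure_qball_le_growth_mul hr ht)).trans_eq ENNReal.toReal_mul

-- The ball itself need not be open: its points with a ball around them form the required open set.
theorem qball_mem_nhds (h : IsHomogeneousType d μ A₀ A₁) (x : X) {r : ℝ} (hr : 0 < r) :
    qball d x r ∈ 𝓝 x := by
  have hA₀ := h.quasi_pos
  refine mem_nhds_iff.2 ⟨{z | ∃ s > 0, qball d z s ⊆ qball d x r}, ?_, ?_, r, hr, subset_rfl⟩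
  · rintro z ⟨s, hs, hz⟩
    exact hz (h.mem_qball_self z hs)
  · refine (h.isOpen_iff _).2 ?_
    rintro z ⟨s, hs, hz⟩
    refine ⟨s / (2 * A₀), by positivity, fun y (hy : d z y < s / (2 * A₀)) =>
      ⟨s / (2 * A₀), by positivity, (h.qball_subset_qball ?_).trans hz⟩⟩
    calc A₀ * (d z y + s / (2 * A₀)) ≤ A₀ * (s / (2 * A₀) + s / (2 * A₀)) := by gcongr
      _ = s := by field_simp; ring

theorem notMem_closure (h : IsHomogeneousType d μ A₀ A₁) {x : X} {r : ℝ} (hr : 0 < r) {S : Set X}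
    (hS : ∀ y ∈ S, r ≤ d x y) : x ∉ closure S := by
  rw [mem_closure_iff_nhds]
  intro hx
  obtain ⟨y, hy, hyS⟩ := hx _ (h.qball_mem_nhds x hr)
  exact (hS y hyS).not_gt hy

theorem closure_qball_subset (h : IsHomogeneousType d μ A₀ A₁) (x : X) {r : ℝ} (hr : 0 < r) :
    closure (qball d x r) ⊆ qball d x (2 * A₀ * r) := by
  have hA₀ := h.quasi_pos
  intro y hy
  obtain ⟨z, hyz : d y z < r, hxz : d x z < r⟩ :=
    mem_closure_iff_nhds.1 hy _ (h.qball_mem_nhds y hr)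
  calc d x y ≤ A₀ * (d x z + d z y) := h.quasi_triangle x y z
    _ < A₀ * (r + r) := by rw [h.dist_symm z y]; gcongr
    _ = 2 * A₀ * r := by ring

end IsHomogeneousType

/-! ### Kernels on far balls -/

theorem exists_pos_forall_le_of_tendsto {ω : ℝ → ℝ} (hω : Tendsto ω (𝓝[>] 0) (𝓝 0)) {ε : ℝ}
    (hε : 0 < ε) (a : ℝ) : ∃ η > 0, a * η < 1 ∧ ∀ t ∈ Set.Ioc 0 η, ω t ≤ ε := by
  have ha : Tendsto (fun t => a * t) (𝓝[>] 0) (𝓝 0) :=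
    (Continuous.tendsto' (by fun_prop) 0 0 (mul_zero a)).mono_left nhdsWithin_le_nhds
  obtain ⟨η, hη, H⟩ := mem_nhdsGT_iff_exists_Ioc_subset.1
    ((ha.eventually_lt_const one_pos).and (hω.eventually_le_const hε))
  exact ⟨η, hη, (H ⟨hη, le_rfl⟩).1, fun t ht => (H ht).2⟩

theorem IsModulus.tendsto_nhdsGT {ω : ℝ → ℝ} (hω : IsModulus ω) : Tendsto ω (𝓝[>] 0) (𝓝 0) := by
  have hcont := hω.continuousOn 0 (Set.left_mem_Icc.2 zero_le_one)
  rw [ContinuousWithinAt, hω.zero, nhdsWithin_Icc_eq_nhdsGE zero_lt_one] at hcont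
  exact hcont.mono_left (nhdsWithin_mono _ Set.Ioi_subset_Ici_self)

section Kernel

variable [TopologicalSpace X] [MeasurableSpace X] [BorelSpace X] {d : X → X → ℝ} {μ : Measure X}
  {A₀ A₁ cK ε η : ℝ} {ω : ℝ → ℝ} {K : X → X → ℂ}

theorem IsCZKernel.norm_sub_add_norm_sub_le (h : IsHomogeneousType d μ A₀ A₁)
    (hK : IsCZKernel d μ A₀ cK ω K) (hε : 0 ≤ ε) (hη : 2 * A₀ * η < 1)
    (hωε : ∀ t ∈ Set.Ioc 0 η, ω t ≤ ε) {x x' y : X} (hx : d x x' ≤ η * d x y) :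
    ‖K x y - K x' y‖ + ‖K y x - K y x'‖ ≤ ε / vol d μ x y := by
  have hA₀ := h.quasi_pos
  rcases eq_or_ne x x' with rfl | hne
  · simpa [vol] using div_nonneg hε measureReal_nonneg
  have hxx' : 0 < d x x' :=
    (h.dist_nonneg x x').lt_of_ne fun h0 => hne ((h.dist_eq_zero x x').1 h0.symm)
  have hxy : 0 < d x y :=
    (h.dist_nonneg x y).lt_of_ne fun h0 => by simp [← h0] at hx; linarith
  have hlt : d x x' < (2 * A₀)⁻¹ * d x y := by
    refine hx.trans_lt ?_
    gcongr
    rwa [← one_div, lt_div_iff₀' (by positivity)]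
  calc ‖K x y - K x' y‖ + ‖K y x - K y x'‖
      ≤ 1 / vol d μ x y * ω (d x x' / d x y) := hK.regularity x x' y hlt
    _ ≤ 1 / vol d μ x y * ε := by
      gcongr
      · exact one_div_nonneg.2 measureReal_nonneg
      · exact hωε _ ⟨by positivity, (div_le_iff₀ hxy).2 hx⟩
    _ = ε / vol d μ x y := one_div_mul_eq_div _ _

theorem IsCZKernel.continuousOn (h : IsHomogeneousType d μ A₀ A₁)
    (hω : Tendsto ω (𝓝[>] 0) (𝓝 0)) (hK : IsCZKernel d μ A₀ cK ω K) (x : X) :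
    ContinuousOn (K x) {x}ᶜ := by
  intro y (hyx : y ≠ x)
  have hd : 0 < d y x :=
    (h.dist_nonneg y x).lt_of_ne fun h0 => hyx ((h.dist_eq_zero y x).1 h0.symm)
  have hV : 0 < vol d μ y x := h.measureReal_qball_pos y hd
  refine ContinuousAt.continuousWithinAt (Metric.continuousAt_iff'.2 fun δ hδ => ?_)
  obtain ⟨η, hη, hη₀, hωη⟩ :=
    exists_pos_forall_le_of_tendsto hω (ε := δ / 2 * vol d μ y x) (by positivity) (2 * A₀)
  filter_upwards [h.qball_mem_nhds y (r := η * d y x) (by positivity)] with z hz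
  have hreg := hK.norm_sub_add_norm_sub_le h (by positivity) hη₀ hωη (le_of_lt hz)
  rw [mul_div_cancel_right₀ _ hV.ne'] at hreg
  rw [dist_comm, dist_eq_norm]
  linarith [norm_nonneg (K y x - K z x)]

theorem IsCZKernel.norm_sub_left_le (h : IsHomogeneousType d μ A₀ A₁)
    (hK : IsCZKernel d μ A₀ cK ω K) (hε : 0 ≤ ε) (hη : 2 * A₀ * η < 1)
    (hωε : ∀ t ∈ Set.Ioc 0 η, ω t ≤ ε) {R : ℝ} {x x' y : X} (hR : 0 < R) (hxy : R ≤ d x y)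
    (hx : d x x' ≤ η * d x y) : ‖K x y - K x' y‖ ≤ ε / μ.real (qball d x R) := by
  have hV : μ.real (qball d x R) ≤ vol d μ x y :=
    measureReal_mono (qball_mono d x hxy) (h.ball_lt_top _ _ (hR.trans_le hxy)).ne
  have hVpos := h.measureReal_qball_pos x hR
  calc ‖K x y - K x' y‖ ≤ ε / vol d μ x y :=
        (le_add_of_nonneg_right (norm_nonneg _)).trans
          (hK.norm_sub_add_norm_sub_le h hε hη hωε hx)
    _ ≤ ε / μ.real (qball d x R) := by gcongr

theorem IsCZKernel.norm_sub_right_le (h : IsHomogeneousType d μ A₀ A₁)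
    (hK : IsCZKernel d μ A₀ cK ω K) (hε : 0 ≤ ε) (hη : 2 * A₀ * η < 1)
    (hωε : ∀ t ∈ Set.Ioc 0 η, ω t ≤ ε) {R t : ℝ} {x₀ x y y' : X} (hR : 0 < R) (hyx : 0 < d y x)
    (hy : d y y' ≤ η * d y x) (ht : A₀ * (d y x₀ + R) ≤ t * d y x) :
    ‖K x y - K x y'‖ ≤ growth A₁ t * ε / μ.real (qball d x₀ R) := by
  have hV : μ.real (qball d x₀ R) ≤ growth A₁ t * vol d μ y x :=
    h.measureReal_qball_le_growth_mul hyx ht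
  have hVpos := h.measureReal_qball_pos x₀ hR
  have hVpos' : 0 < vol d μ y x := h.measureReal_qball_pos y hyx
  calc ‖K x y - K x y'‖ ≤ ε / vol d μ y x :=
        (le_add_of_nonneg_left (norm_nonneg _)).trans
          (hK.norm_sub_add_norm_sub_le h hε hη hωε hy)
    _ ≤ growth A₁ t * ε / μ.real (qball d x₀ R) := by
        rw [div_le_div_iff₀ hVpos' hVpos]
        nlinarith

theorem IsCZKernel.norm_sub_le (h : IsHomogeneousType d μ A₀ A₁) (hK : IsCZKernel d μ A₀ cK ω K)
    (hε : 0 ≤ ε) (hη : 2 * A₀ * η < 1) (hωε : ∀ t ∈ Set.Ioc 0 η, ω t ≤ ε) {r R C : ℝ}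
    {x₀ y₀ x y : X} (hR : 0 < R) (hr : 2 * A₀ * r ≤ η * R) (hxy : R ≤ d x₀ y₀)
    (hxy' : d x₀ y₀ ≤ C * R) (hx : x ∈ qball d x₀ r) (hy : y ∈ qball d y₀ r) :
    ‖K x y - K x₀ y₀‖ ≤
      (1 + growth A₁ (2 * A₀ ^ 2 * (C + 1))) * ε / μ.real (qball d x₀ R) := by
  have hA₀ := h.quasi_pos
  have hA₀' := h.one_le_quasi
  have hx' : d x₀ x < r := hx
  have hy' : d y₀ y < r := hy
  have hr0 : 0 < r := (h.dist_nonneg x₀ x).trans_lt hx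
  have hη0 : 0 < η := pos_of_mul_pos_left (lt_of_lt_of_le (by positivity) hr) hR.le
  have hfar : R ≤ 2 * A₀ * d y₀ x := by
    rw [h.dist_symm]
    exact h.le_two_mul_dist (hr.trans (by nlinarith)) hxy hx
  have hyx : 0 < d y₀ x := pos_of_mul_pos_right (hR.trans_le hfar) (by positivity)
  have hbig : A₀ * (d y₀ x₀ + R) ≤ 2 * A₀ ^ 2 * (C + 1) * d y₀ x := by
    have hC : 0 < C + 1 := by nlinarith
    calc A₀ * (d y₀ x₀ + R) ≤ A₀ * (C * R + R) := by rw [h.dist_symm]; gcongr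
      _ = A₀ * (C + 1) * R := by ring
      _ ≤ A₀ * (C + 1) * (2 * A₀ * d y₀ x) := by gcongr
      _ = 2 * A₀ ^ 2 * (C + 1) * d y₀ x := by ring
  calc ‖K x y - K x₀ y₀‖ ≤ ‖K x₀ y₀ - K x y₀‖ + ‖K x y₀ - K x y‖ := by
        rw [norm_sub_rev]
        exact norm_sub_le_norm_sub_add_norm_sub _ _ _
    _ ≤ ε / μ.real (qball d x₀ R) +
          growth A₁ (2 * A₀ ^ 2 * (C + 1)) * ε / μ.real (qball d x₀ R) :=
        add_le_add (hK.norm_sub_left_le h hε hη hωε hR hxy (by nlinarith))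
          (hK.norm_sub_right_le h hε hη hωε hR hyx (by nlinarith) hbig)
    _ = _ := by ring

/-- The kernel `K` is almost constant on the product of the separated balls `B(x₀, r)` and
`B(y₀, r)`. A commutator with `K` tested on functions supported in the second ball sees the
oscillation of its symbol on the first; the tolerance `1 / 6` is what
`measure_univ_mul_lintegral_enorm_sub_average_le` can absorb. -/
structure IsTestPair (d : X → X → ℝ) (K : X → X → ℂ) (x₀ y₀ : X) (r : ℝ) : Prop where
  le_dist : ∀ x ∈ qball d x₀ r, ∀ y ∈ qball d y₀ r, r ≤ d x y
  kernel_ne_zero : K x₀ y₀ ≠ 0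
  norm_kernel_sub_le : ∀ x ∈ qball d x₀ r, ∀ y ∈ qball d y₀ r,
    ‖K x y - K x₀ y₀‖ ≤ ‖K x₀ y₀‖ / 6

theorem IsNondegenerate.exists_isTestPair (h : IsHomogeneousType d μ A₀ A₁)
    (hK : IsCZKernel d μ A₀ cK ω K) {c₀ Cbar : ℝ} (hnd : IsNondegenerate d μ c₀ Cbar K)
    (hε : 0 ≤ ε) (hη₀ : 0 < η) (hη : 2 * A₀ * η < 1) (hωε : ∀ t ∈ Set.Ioc 0 η, ω t ≤ ε)
    (hε' : 6 * c₀ * (1 + growth A₁ (2 * A₀ ^ 2 * (Cbar + 1))) * ε ≤ 1) (x₀ : X) {r : ℝ}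
    (hr : 0 < r) :
    ∃ y₀, IsTestPair d K x₀ y₀ r ∧ d x₀ y₀ ≤ Cbar * (2 * A₀ / η * r) ∧
      ‖K x₀ y₀‖⁻¹ ≤ c₀ * μ.real (qball d x₀ (2 * A₀ / η * r)) := by
  obtain ⟨hc₀, -, hnd⟩ := hnd
  have hA₀ := h.quasi_pos
  have hR : 0 < 2 * A₀ / η * r := by positivity
  obtain ⟨y₀, ⟨hy₀ : d x₀ y₀ < _, hy₀'⟩, hK₀⟩ := hnd x₀ _ hR
  have hfar : 2 * A₀ / η * r ≤ d x₀ y₀ := not_lt.1 hy₀'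
  have hV := h.measureReal_qball_pos x₀ hR
  have hKpos : 0 < ‖K x₀ y₀‖ := lt_of_lt_of_le (by positivity) hK₀
  have hrR : 2 * A₀ * r ≤ η * (2 * A₀ / η * r) := by field_simp; rfl
  refine ⟨y₀, ⟨fun x hx y hy => h.le_dist_of_mem_qball ?_ hfar hx hy, norm_pos_iff.1 hKpos,
    fun x hx y hy => ?_⟩, hy₀.le, ?_⟩
  · calc 4 * A₀ ^ 2 * r = 2 * A₀ * η * (2 * A₀ / η * r) := by field_simp; ring
      _ ≤ 2 * A₀ / η * r := mul_le_of_le_one_left hR.le hη.le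
  · calc ‖K x y - K x₀ y₀‖
        ≤ (1 + growth A₁ (2 * A₀ ^ 2 * (Cbar + 1))) * ε / μ.real (qball d x₀ (2 * A₀ / η * r)) :=
          hK.norm_sub_le h hε hη hωε hR hrR hfar hy₀.le hx hy
      _ ≤ 1 / (6 * c₀) / μ.real (qball d x₀ (2 * A₀ / η * r)) := by
          gcongr
          rw [le_div_iff₀ (by positivity)]
          linarith
      _ = 1 / (c₀ * μ.real (qball d x₀ (2 * A₀ / η * r))) / 6 := by field_simp
      _ ≤ ‖K x₀ y₀‖ / 6 := by gcongr
  · rw [one_div] at hK₀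
    exact inv_le_of_inv_le₀ (by positivity) hK₀

end Kernel

/-! ### The commutator off the support -/

theorem support_trunc_subset (h : X → ℂ) (n : ℕ) :
    Function.support (trunc h n) ⊆ Function.support h := fun x hx hhx =>
  hx (by simp [trunc, hhx])

section Commutator

variable [MeasurableSpace X] {μ : Measure X}

theorem tendsto_eLpNorm_trunc_truncLevel_sub {h : X → ℂ} (hh : Measurable h) (h1 : MemLp h 1 μ) :
    Tendsto (fun k => eLpNorm (trunc h (truncLevel μ h k) - h) 1 μ) atTop (𝓝 0) :=
  tendsto_of_tendsto_of_tendsto_of_le_of_le tendsto_const_nhds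
    (ENNReal.tendsto_pow_atTop_nhds_zero_of_lt_one (ENNReal.inv_lt_one.2 (by norm_num)))
    (fun _ => zero_le) fun k => (eLpNorm_sub_comm _ _ _ _).trans_le (truncLevel_spec hh h1 k)

theorem tendsto_integral_mul_of_tendsto_eLpNorm {ι 𝕜 : Type*} [RCLike 𝕜] {l : Filter ι}
    {k h : X → 𝕜} {u : ι → X → 𝕜} (hk : MemLp k ∞ μ) (hh : MemLp h 1 μ)
    (hu : ∀ i, MemLp (u i) 1 μ) (hlim : Tendsto (fun i => eLpNorm (u i - h) 1 μ) l (𝓝 0)) :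
    Tendsto (fun i => ∫ y, k y * u i y ∂μ) l (𝓝 (∫ y, k y * h y ∂μ)) := by
  have hint : ∀ {v : X → 𝕜}, MemLp v 1 μ → Integrable (fun y => k y * v y) μ := fun hv =>
    memLp_one_iff_integrable.1 (hv.mul hk)
  refine tendsto_integral_of_L1' _ (hint hh).aestronglyMeasurable
    (.of_forall fun i => hint (hu i)) ?_
  have hbound : Tendsto (fun i => eLpNorm k ∞ μ * eLpNorm (u i - h) 1 μ) l (𝓝 0) := by
    simpa using ENNReal.Tendsto.const_mul hlim (Or.inr hk.2.ne)
  refine tendsto_of_tendsto_of_tendsto_of_le_of_le tendsto_const_nhds hbound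
    (fun _ => zero_le) fun i => ?_
  calc eLpNorm ((fun y => k y * u i y) - fun y => k y * h y) 1 μ
      = eLpNorm (k • (u i - h)) 1 μ := by
        congr 1 with y
        simp only [Pi.sub_apply, Pi.smul_apply', smul_eq_mul, mul_sub]
    _ ≤ eLpNorm k ∞ μ * eLpNorm (u i - h) 1 μ :=
        eLpNorm_smul_le_mul_eLpNorm ((hu i).sub hh).aestronglyMeasurable hk.aestronglyMeasurable

variable [TopologicalSpace X] {T : Lp ℂ 2 μ →L[ℂ] Lp ℂ 2 μ} {K : X → X → ℂ} {S : Set X}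

theorem HasKernel.applyL2_eq_setIntegral (hT : HasKernel T K) {f : X → ℂ} (hf : Measurable f)
    (hf2 : MemLp f 2 μ) (hS : Function.support f ⊆ S) :
    ∀ᵐ x ∂μ, x ∉ closure S → applyL2 T f x = ∫ y in S, K x y * f y ∂μ := by
  filter_upwards [hT f hf hf2] with x hx hxS
  rw [hx fun hx' => hxS (closure_mono hS hx')]
  refine (setIntegral_eq_integral_of_forall_compl_eq_zero fun y hy => ?_).symm
  rw [Function.notMem_support.1 fun hy' => hy (hS hy'), mul_zero]

theorem HasKernel.applyL1_eq_setIntegral (hT : HasKernel T K) {h : X → ℂ} (hh : Measurable h)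
    (h1 : MemLp h 1 μ) (hS : Function.support h ⊆ S) :
    ∀ᵐ x ∂μ, x ∉ closure S → MemLp (K x) ∞ (μ.restrict S) →
      applyL1 T h x = ∫ y in S, K x y * h y ∂μ := by
  have htrunc : ∀ᵐ x ∂μ, ∀ k, x ∉ closure S → applyL2 T (trunc h (truncLevel μ h k)) x =
      ∫ y in S, K x y * trunc h (truncLevel μ h k) y ∂μ :=
    ae_all_iff.2 fun k => hT.applyL2_eq_setIntegral (measurable_trunc hh _)
      (memLp_trunc hh h1 _).2 ((support_trunc_subset h _).trans hS)
  have hlim : Tendsto (fun k => eLpNorm (trunc h (truncLevel μ h k) - h) 1 (μ.restrict S)) atTop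
      (𝓝 0) :=
    tendsto_of_tendsto_of_tendsto_of_le_of_le tendsto_const_nhds
      (tendsto_eLpNorm_trunc_truncLevel_sub hh h1) (fun _ => zero_le)
      fun _ => eLpNorm_restrict_le _ _ _ _
  filter_upwards [htrunc] with x hx hxS hK
  exact ((tendsto_integral_mul_of_tendsto_eLpNorm hK (h1.restrict S)
    (fun k => (memLp_trunc hh h1 _).1.restrict S) hlim).congr fun k => (hx k hxS).symm).limUnder_eq

theorem HasKernel.commutator_eq_setIntegral (hT : HasKernel T K) {b f : X → ℂ}
    (hb : Measurable b) (hf : Measurable f) (hf1 : MemLp f 1 μ) (hf2 : MemLp f 2 μ)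
    (hbf : MemLp (fun y => b y * f y) 1 μ) (hS : Function.support f ⊆ S) :
    ∀ᵐ x ∂μ, x ∉ closure S → MemLp (K x) ∞ (μ.restrict S) →
      commutator b T f x = ∫ y in S, K x y * ((b x - b y) * f y) ∂μ := by
  have hS' : Function.support (fun y => b y * f y) ⊆ S :=
    (Function.support_mul_subset_right b f).trans hS
  filter_upwards [hT.applyL2_eq_setIntegral hf hf2 hS,
    hT.applyL1_eq_setIntegral (h := fun y => b y * f y) (hb.mul hf) hbf hS'] with x hx2 hx1 hxS hK
  have hint : ∀ {u : X → ℂ}, MemLp u 1 μ → IntegrableOn (fun y => K x y * u y) S μ := fun hu =>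
    memLp_one_iff_integrable.1 ((hu.restrict S).mul hK)
  rw [commutator, hx2 hxS, hx1 hxS hK, ← integral_const_mul,
    ← integral_sub ((hint hf1).const_mul _) (hint hbf)]
  congr 1 with y
  ring

end Commutator

/-! ### Oscillation and its duality -/

section Oscillation

variable {Y E : Type*} [MeasurableSpace X] [MeasurableSpace Y] {μ : Measure X} {ν : Measure Y}

section Average

variable [IsFiniteMeasure μ] [NormedAddCommGroup E] [NormedSpace ℝ E] [CompleteSpace E]

theorem measure_univ_mul_enorm_sub_average {f : X → E} (hf : Integrable f μ) (a : E) :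
    μ Set.univ * ‖a - ⨍ z, f z ∂μ‖ₑ = ‖∫ z, (a - f z) ∂μ‖ₑ := by
  have hsmul : ∫ z, (a - f z) ∂μ = μ.real Set.univ • (a - ⨍ z, f z ∂μ) := by
    rw [integral_sub (integrable_const a) hf, integral_const, smul_sub, measure_smul_average]
  rw [hsmul, enorm_smul, Real.enorm_of_nonneg measureReal_nonneg,
    ofReal_measureReal (measure_ne_top _ _)]

theorem lintegral_enorm_sub_average_le {f : X → E} (hf : Integrable f μ) (a : E) :
    ∫⁻ x, ‖f x - ⨍ z, f z ∂μ‖ₑ ∂μ ≤ 2 * ∫⁻ x, ‖f x - a‖ₑ ∂μ := by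
  have haverage : μ Set.univ * ‖a - ⨍ z, f z ∂μ‖ₑ ≤ ∫⁻ x, ‖f x - a‖ₑ ∂μ := by
    rw [measure_univ_mul_enorm_sub_average hf]
    simpa only [enorm_sub_rev a] using enorm_integral_le_lintegral_enorm (μ := μ) fun x => a - f x
  calc ∫⁻ x, ‖f x - ⨍ z, f z ∂μ‖ₑ ∂μ
      ≤ ∫⁻ x, (‖f x - a‖ₑ + ‖a - ⨍ z, f z ∂μ‖ₑ) ∂μ := by
        gcongr with x
        rw [← sub_add_sub_cancel (f x) a]
        exact enorm_add_le _ _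
    _ = ∫⁻ x, ‖f x - a‖ₑ ∂μ + μ Set.univ * ‖a - ⨍ z, f z ∂μ‖ₑ := by
        rw [lintegral_add_right _ measurable_const, lintegral_const, mul_comm (μ _)]
    _ ≤ 2 * ∫⁻ x, ‖f x - a‖ₑ ∂μ := by
        rw [two_mul]
        gcongr

end Average

theorem lintegral_lintegral_enorm_sub_le [IsFiniteMeasure ν] [NormedAddCommGroup E]
    (f : X → E) (g : Y → E) (a : E) :
    ∫⁻ x, ∫⁻ y, ‖f x - g y‖ₑ ∂ν ∂μ ≤
      ν Set.univ * ∫⁻ x, ‖f x - a‖ₑ ∂μ + μ Set.univ * ∫⁻ y, ‖g y - a‖ₑ ∂ν := by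
  calc ∫⁻ x, ∫⁻ y, ‖f x - g y‖ₑ ∂ν ∂μ ≤ ∫⁻ x, ∫⁻ y, (‖f x - a‖ₑ + ‖g y - a‖ₑ) ∂ν ∂μ := by
        gcongr with x y
        rw [← sub_sub_sub_cancel_right (f x) (g y) a]
        exact enorm_sub_le
    _ = ∫⁻ x, (ν Set.univ * ‖f x - a‖ₑ + ∫⁻ y, ‖g y - a‖ₑ ∂ν) ∂μ := by
        congr 1 with x
        rw [lintegral_add_left measurable_const, lintegral_const, mul_comm]
    _ = _ := by
        rw [lintegral_add_right _ measurable_const, lintegral_const, mul_comm (μ _),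
          lintegral_const_mul' _ _ (measure_ne_top _ _)]

variable {𝕜 : Type*} [RCLike 𝕜] {f : X → 𝕜} {g : Y → 𝕜}

theorem enorm_le_one_of_norm_le_one [SeminormedAddGroup E] {x : E} (hx : ‖x‖ ≤ 1) :
    ‖x‖ₑ ≤ 1 := by
  rwa [← ofReal_norm, ENNReal.ofReal_le_one]

theorem exists_measurable_mul_eq_norm (hg : Measurable g) :
    ∃ φ : Y → 𝕜, Measurable φ ∧ (∀ y, ‖φ y‖ ≤ 1) ∧ ∀ y, g y * φ y = (‖g y‖ : 𝕜) := by
  refine ⟨fun y => starRingEnd 𝕜 (g y) / (‖g y‖ : 𝕜),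
    (RCLike.continuous_conj.measurable.comp hg).div (RCLike.measurable_ofReal.comp hg.norm),
    fun y => ?_, fun y => ?_⟩
  · simpa using div_self_le_one ‖g y‖
  · rcases eq_or_ne (g y) 0 with h | h
    · simp [h]
    · rw [mul_div_assoc', RCLike.mul_conj, sq, mul_div_cancel_right₀ _ (by simpa using h)]

theorem measure_univ_mul_lintegral_enorm_le [IsFiniteMeasure ν] {φ : Y → 𝕜} {a : 𝕜}
    (hg : Integrable g ν) (hφ : AEStronglyMeasurable φ ν) (hφ1 : ∀ y, ‖φ y‖ ≤ 1)
    (hφg : ∀ y, (g y - a) * φ y = (‖g y - a‖ : 𝕜)) (hf : AEStronglyMeasurable f μ) :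
    μ Set.univ * ∫⁻ y, ‖g y - a‖ₑ ∂ν ≤
      ∫⁻ x, ‖∫ y, (f x - g y) * φ y ∂ν‖ₑ ∂μ + ν Set.univ * ∫⁻ x, ‖f x - a‖ₑ ∂μ := by
  have hφint : Integrable φ ν := Integrable.of_bound hφ 1 (.of_forall hφ1)
  have hgφ : Integrable (fun y => g y * φ y) ν := hg.mul_bdd hφ (.of_forall hφ1)
  have hpoint : ∀ x, ∫⁻ y, ‖g y - a‖ₑ ∂ν ≤
      ‖∫ y, (f x - g y) * φ y ∂ν‖ₑ + ν Set.univ * ‖f x - a‖ₑ := fun x =>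
    calc ∫⁻ y, ‖g y - a‖ₑ ∂ν = ‖∫ y, (g y - a) * φ y ∂ν‖ₑ := by
          simp only [hφg]
          rw [integral_ofReal, ← ofReal_norm, RCLike.norm_ofReal,
            abs_of_nonneg (integral_nonneg fun y => norm_nonneg _)]
          exact (ofReal_integral_norm_eq_lintegral_enorm (hg.sub (integrable_const a))).symm
      _ = ‖(∫ y, (f x - a) * φ y ∂ν) - ∫ y, (f x - g y) * φ y ∂ν‖ₑ := by
          rw [← integral_sub (hφint.const_mul _)]
          · congr 2 with y
            ring
          · simp only [sub_mul]
            exact (hφint.const_mul (f x)).sub hgφ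
      _ ≤ ν Set.univ * ‖f x - a‖ₑ + ‖∫ y, (f x - g y) * φ y ∂ν‖ₑ := by
          refine enorm_sub_le.trans (add_le_add_left ?_ _)
          refine (enorm_integral_le_lintegral_enorm _).trans ?_
          rw [mul_comm, ← lintegral_const]
          gcongr with y
          rw [enorm_mul]
          exact mul_le_of_le_one_right' (enorm_le_one_of_norm_le_one (hφ1 y))
      _ = _ := add_comm _ _
  have hfa : AEMeasurable (fun x => ν Set.univ * ‖f x - a‖ₑ) μ :=
    (hf.sub aestronglyMeasurable_const).enorm.const_mul _
  calc μ Set.univ * ∫⁻ y, ‖g y - a‖ₑ ∂ν = ∫⁻ _, ∫⁻ y, ‖g y - a‖ₑ ∂ν ∂μ := by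
        rw [lintegral_const, mul_comm]
    _ ≤ _ := lintegral_mono hpoint
    _ = _ := by
        rw [lintegral_add_right' _ hfa, lintegral_const_mul' _ _ (measure_ne_top _ _)]

theorem add_inv_six_mul_le_two_mul {D Φ : ℝ≥0∞} (hD : D ≠ ∞)
    (h : D ≤ Φ + 6⁻¹ * D + 2 * (Φ + 6⁻¹ * D)) : Φ + 6⁻¹ * D ≤ 2 * Φ := by
  rcases eq_or_ne Φ ∞ with rfl | hΦ
  · simp
  lift D to ℝ≥0 using hD
  lift Φ to ℝ≥0 using hΦ
  have h6 : (6⁻¹ : ℝ≥0∞) = ((6⁻¹ : ℝ≥0) : ℝ≥0∞) := by simp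
  rw [h6] at h ⊢
  norm_cast at h ⊢
  rw [← NNReal.coe_le_coe] at h ⊢
  push_cast at h ⊢
  linarith

/-- The constant `6⁻¹` is small enough for the double oscillation, which duality bounds by three
times the left-hand side of the testing condition, to be absorbed. -/
theorem measure_univ_mul_lintegral_enorm_sub_average_le [IsFiniteMeasure μ] [IsFiniteMeasure ν]
    {Φ : ℝ≥0∞} (hf : Integrable f μ) (hg : Integrable g ν) (hgm : Measurable g)
    (htest : ∀ φ : Y → 𝕜, Measurable φ → (∀ y, ‖φ y‖ ≤ 1) →
      ∫⁻ x, ‖∫ y, (f x - g y) * φ y ∂ν‖ₑ ∂μ ≤ Φ + 6⁻¹ * ∫⁻ x, ∫⁻ y, ‖f x - g y‖ₑ ∂ν ∂μ) :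
    ν Set.univ * ∫⁻ x, ‖f x - ⨍ z, f z ∂μ‖ₑ ∂μ ≤ 4 * Φ := by
  set a := ⨍ y, g y ∂ν with ha
  set D := ∫⁻ x, ∫⁻ y, ‖f x - g y‖ₑ ∂ν ∂μ
  have hsplit : D ≤ ν Set.univ * ∫⁻ x, ‖f x - a‖ₑ ∂μ + μ Set.univ * ∫⁻ y, ‖g y - a‖ₑ ∂ν :=
    lintegral_lintegral_enorm_sub_le f g a
  have hD_top : D ≠ ∞ := ne_top_of_le_ne_top (ENNReal.add_ne_top.2
    ⟨ENNReal.mul_ne_top (measure_ne_top _ _) (hf.sub (integrable_const a)).2.ne,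
      ENNReal.mul_ne_top (measure_ne_top _ _) (hg.sub (integrable_const a)).2.ne⟩) hsplit
  have hf_le : ν Set.univ * ∫⁻ x, ‖f x - a‖ₑ ∂μ ≤ Φ + 6⁻¹ * D := by
    rw [← lintegral_const_mul' _ _ (measure_ne_top _ _)]
    simpa only [measure_univ_mul_enorm_sub_average hg, ha, Pi.one_apply, mul_one] using
      htest 1 measurable_one fun y => by simp
  have hg_le : μ Set.univ * ∫⁻ y, ‖g y - a‖ₑ ∂ν ≤ 2 * (Φ + 6⁻¹ * D) := by
    obtain ⟨φ, hφ, hφ1, hφg⟩ := exists_measurable_mul_eq_norm (hgm.sub_const a)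
    rw [two_mul]
    exact (measure_univ_mul_lintegral_enorm_le hg hφ.aestronglyMeasurable hφ1 hφg hf.1).trans
      (add_le_add (htest φ hφ hφ1) hf_le)
  have hΦD : Φ + 6⁻¹ * D ≤ 2 * Φ :=
    add_inv_six_mul_le_two_mul hD_top (hsplit.trans (add_le_add hf_le hg_le))
  calc ν Set.univ * ∫⁻ x, ‖f x - ⨍ z, f z ∂μ‖ₑ ∂μ
      ≤ ν Set.univ * (2 * ∫⁻ x, ‖f x - a‖ₑ ∂μ) := by
        gcongr
        exact lintegral_enorm_sub_average_le hf a
    _ = 2 * (ν Set.univ * ∫⁻ x, ‖f x - a‖ₑ ∂μ) := mul_left_comm _ _ _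
    _ ≤ 2 * (2 * Φ) := by exact mul_le_mul_right (hf_le.trans hΦD) 2
    _ = 4 * Φ := by rw [← mul_assoc]; norm_num

end Oscillation

/-! ### Weighted norms of indicators and the Bloom weight -/

section Weights

variable {p q : ℝ} {w w₁ w₂ : X → ℝ}

theorem ofReal_rpow_rpow_half {t a : ℝ} (ht : 0 < t) (ha : a ≠ 0) :
    ENNReal.ofReal (t ^ a) ^ (1 / a / 2) = ENNReal.ofReal (t ^ (1 / 2 : ℝ)) := by
  rw [ENNReal.ofReal_rpow_of_pos (by positivity), ← Real.rpow_mul ht.le]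
  congr 2
  field_simp

theorem bloomWeight_pos (hw₁ : ∀ x, 0 < w₁ x) (hw₂ : ∀ x, 0 < w₂ x) (x : X) :
    0 < bloomWeight p q w₁ w₂ x :=
  Real.rpow_pos_of_pos (div_pos (hw₁ x) (hw₂ x)) _

theorem bloomWeight_rpow_mul_rpow_mul_rpow_eq_one {x : X} (hp : p.conjExponent ≠ 0) (hq : q ≠ 0)
    (hs : 1 / p + 1 / q.conjExponent ≠ 0) (hw₁ : 0 < w₁ x) (hw₂ : 0 < w₂ x) :
    ENNReal.ofReal (bloomWeight p q w₁ w₂ x) ^ ((1 / p + 1 / q.conjExponent) / 2) *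
        ENNReal.ofReal (w₁⁻¹ x ^ p.conjExponent) ^ (1 / p.conjExponent / 2) *
      ENNReal.ofReal (w₂ x ^ q) ^ (1 / q / 2) = 1 := by
  have hν := ofReal_rpow_rpow_half (div_pos hw₁ hw₂) (one_div_ne_zero hs)
  rw [one_div_one_div] at hν
  rw [bloomWeight, hν, Pi.inv_apply, ofReal_rpow_rpow_half (inv_pos.2 hw₁) hp,
    ofReal_rpow_rpow_half hw₂ hq, ← ENNReal.ofReal_mul (by positivity),
    ← ENNReal.ofReal_mul (by positivity), ← Real.mul_rpow (by positivity) (by positivity),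
    ← Real.mul_rpow (by positivity) (by positivity), div_mul_eq_mul_div,
    mul_inv_cancel₀ hw₁.ne', div_mul_cancel₀ _ hw₂.ne', Real.one_rpow, ENNReal.ofReal_one]

variable [MeasurableSpace X] {μ : Measure X} {d : X → X → ℝ} {S : Set X}

/-- The norm `‖1_E‖_{L^p_w} = (∫_E w ^ p dμ) ^ (1 / p)`. The `A_{p,p}` condition on `w` compares it
with the dual norm `‖1_E‖_{L^{p'}_{1/w}}`. -/
def indicatorNorm (μ : Measure X) (p : ℝ) (w : X → ℝ) (E : Set X) : ℝ≥0∞ :=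
  wmeas μ (fun x => w x ^ p) E ^ (1 / p)

theorem indicatorNorm_mono (hp : 0 ≤ p) {E : Set X} (hE : E ⊆ S) :
    indicatorNorm μ p w E ≤ indicatorNorm μ p w S :=
  ENNReal.rpow_le_rpow (lintegral_mono_set hE) (by positivity)

theorem enorm_mul_ofReal (z : ℂ) {a : ℝ} (ha : 0 ≤ a) :
    ‖z * (a : ℂ)‖ₑ = ‖z‖ₑ * ENNReal.ofReal a := by
  rw [enorm_mul, ← ofReal_norm (a : ℂ), Complex.norm_of_nonneg ha]

theorem wnorm_eq_lintegral_rpow (hp : 0 < p) (hw : ∀ x, 0 ≤ w x) (f : X → ℂ) :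
    wnorm μ p w f = (∫⁻ x, (‖f x‖ₑ * ENNReal.ofReal (w x)) ^ p ∂μ) ^ (1 / p) := by
  rw [wnorm, eLpNorm_eq_lintegral_rpow_enorm_toReal (by simpa using hp) ENNReal.ofReal_ne_top,
    ENNReal.toReal_ofReal hp.le]
  simp only [enorm_mul_ofReal _ (hw _)]

theorem wnorm_indicator_le_indicatorNorm (hp : 0 < p) (hw : ∀ x, 0 ≤ w x) (hS : MeasurableSet S)
    {f : X → ℂ} (hf : ∀ x, ‖f x‖ ≤ 1) : wnorm μ p w (S.indicator f) ≤ indicatorNorm μ p w S := by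
  rw [wnorm_eq_lintegral_rpow hp hw, indicatorNorm, wmeas, ← lintegral_indicator hS]
  gcongr with x
  by_cases hx : x ∈ S
  · rw [Set.indicator_of_mem hx, Set.indicator_of_mem hx,
      ← ENNReal.ofReal_rpow_of_nonneg (hw x) hp.le]
    gcongr
    exact mul_le_of_le_one_left zero_le (enorm_le_one_of_norm_le_one (hf x))
  · simp [hx, hp]

theorem setLIntegral_le_wnorm_mul_indicatorNorm {p' : ℝ} (hp : p.HolderConjugate p')
    (hm : Measurable w) (hw : ∀ x, 0 < w x) {G : X → ℝ≥0∞} (hG : Measurable G) {u : X → ℂ}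
    (hGu : ∀ᵐ x ∂μ.restrict S, G x ≤ ‖u x‖ₑ) :
    ∫⁻ x in S, G x ∂μ ≤ wnorm μ p w u * indicatorNorm μ p' w⁻¹ S := by
  have hmul : ∀ x, G x = G x * ENNReal.ofReal (w x) * ENNReal.ofReal (w⁻¹ x) := fun x => by
    rw [Pi.inv_apply, ENNReal.ofReal_inv_of_pos (hw x), mul_assoc,
      ENNReal.mul_inv_cancel (by simpa using hw x) ENNReal.ofReal_ne_top, mul_one]
  calc ∫⁻ x in S, G x ∂μ = ∫⁻ x in S, G x * ENNReal.ofReal (w x) * ENNReal.ofReal (w⁻¹ x) ∂μ :=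
        lintegral_congr hmul
    _ ≤ (∫⁻ x in S, (G x * ENNReal.ofReal (w x)) ^ p ∂μ) ^ (1 / p) *
        (∫⁻ x in S, ENNReal.ofReal (w⁻¹ x) ^ p' ∂μ) ^ (1 / p') :=
        ENNReal.lintegral_mul_le_Lp_mul_Lq _ hp (hG.mul hm.ennreal_ofReal).aemeasurable
          hm.inv.ennreal_ofReal.aemeasurable
    _ ≤ wnorm μ p w u * indicatorNorm μ p' w⁻¹ S := by
        rw [wnorm_eq_lintegral_rpow hp.pos fun x => (hw x).le, indicatorNorm, wmeas]
        have hp_nonneg := hp.nonneg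
        have hp'_nonneg := hp.symm.nonneg
        gcongr ?_ ^ _ * (∫⁻ x in S, ?_ ∂μ) ^ _
        · refine (lintegral_mono_ae ?_).trans (setLIntegral_le_lintegral S _)
          filter_upwards [hGu] with x hx
          gcongr
        · exact (ENNReal.ofReal_rpow_of_nonneg (inv_pos.2 (hw x)).le hp'_nonneg).le

theorem setLIntegral_le_of_mul_le_enorm_add {p' : ℝ} (hp : p.HolderConjugate p')
    (hm : Measurable w) (hw : ∀ x, 0 < w x) {F E : X → ℝ≥0∞} (hF : Measurable F)
    (hE : Measurable E) {c : ℝ≥0∞} (hc0 : c ≠ 0) (hc : c ≠ ∞) {u : X → ℂ}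
    (hu : ∀ᵐ x ∂μ.restrict S, c * F x ≤ ‖u x‖ₑ + c * E x) :
    ∫⁻ x in S, F x ∂μ ≤
      c⁻¹ * (wnorm μ p w u * indicatorNorm μ p' w⁻¹ S) + ∫⁻ x in S, E x ∂μ := by
  have hsub : ∀ᵐ x ∂μ.restrict S, c * (F x - E x) ≤ ‖u x‖ₑ := by
    filter_upwards [hu] with x hx
    rwa [ENNReal.mul_sub fun _ _ => hc, tsub_le_iff_right]
  have hholder := setLIntegral_le_wnorm_mul_indicatorNorm hp hm hw ((hF.sub hE).const_mul c) hsub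
  rw [lintegral_const_mul' _ _ hc, mul_comm c, ← ENNReal.le_div_iff_mul_le (.inl hc0) (.inl hc),
    ENNReal.div_eq_inv_mul] at hholder
  calc ∫⁻ x in S, F x ∂μ ≤ ∫⁻ x in S, (F x - E x + E x) ∂μ := lintegral_mono fun x => le_tsub_add
    _ = ∫⁻ x in S, (F x - E x) ∂μ + ∫⁻ x in S, E x ∂μ := lintegral_add_right _ hE
    _ ≤ _ := add_le_add_left hholder _

theorem indicatorNorm_mul_indicatorNorm_inv_le (hp : 1 < p) (hw : ∀ x, 0 ≤ w x) (x : X) {r : ℝ}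
    (hr : 0 < r) (h0 : μ (qball d x r) ≠ 0) (ht : μ (qball d x r) ≠ ∞) :
    indicatorNorm μ p w (qball d x r) * indicatorNorm μ p.conjExponent w⁻¹ (qball d x r) ≤
      appConst d μ p w * μ (qball d x r) := by
  have hp0 : 0 < p := one_pos.trans hp
  have hp1 : 0 < p - 1 := sub_pos.2 hp
  have hdual : (fun y => (w y ^ p) ^ (-(1 / (p - 1)))) = fun y => w⁻¹ y ^ p.conjExponent := by
    ext y
    rw [← Real.rpow_mul (hw y), Pi.inv_apply, Real.inv_rpow (hw y), ← Real.rpow_neg (hw y),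
      Real.conjExponent]
    congr 1
    ring
  have hap : wmeas μ (fun y => w y ^ p) (qball d x r) *
      wmeas μ (fun y => w⁻¹ y ^ p.conjExponent) (qball d x r) ^ (p - 1) / μ (qball d x r) ^ p ≤
        apConst d μ p (fun y => w y ^ p) := by
    rw [← hdual]
    exact le_iSup_of_le x (le_iSup_of_le r (le_iSup_of_le hr le_rfl))
  have happ := ENNReal.rpow_le_rpow hap (z := 1 / p) (by positivity)
  rw [ENNReal.div_rpow_of_nonneg _ _ (by positivity),
    ENNReal.mul_rpow_of_nonneg _ _ (by positivity),
    ← ENNReal.rpow_mul, ← ENNReal.rpow_mul, mul_one_div_cancel hp0.ne', ENNReal.rpow_one,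
    ENNReal.div_le_iff h0 ht] at happ
  have hexp : (p - 1) * (1 / p) = 1 / p.conjExponent := by
    rw [Real.conjExponent]
    field_simp
  rwa [hexp] at happ

theorem lintegral_rpow_mul_rpow_mul_rpow_le {f g h : X → ℝ≥0∞} (hf : AEMeasurable f μ)
    (hg : AEMeasurable g μ) (hh : AEMeasurable h μ) {a b c : ℝ} (ha : 0 ≤ a) (hb : 0 ≤ b)
    (hc : 0 ≤ c) (habc : a + b + c = 1) :
    ∫⁻ x, f x ^ a * g x ^ b * h x ^ c ∂μ ≤
      (∫⁻ x, f x ∂μ) ^ a * (∫⁻ x, g x ∂μ) ^ b * (∫⁻ x, h x ∂μ) ^ c := by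
  simpa [Fin.prod_univ_three] using
    ENNReal.lintegral_prod_norm_pow_le (μ := μ) (f := ![f, g, h]) (p := ![a, b, c]) Finset.univ
      (by simp [Fin.forall_fin_succ, hf, hg, hh]) (by simpa [Fin.sum_univ_three] using habc)
      (by simp [Fin.forall_fin_succ, ha, hb, hc])

theorem measurable_bloomWeight (hw₁ : Measurable w₁) (hw₂ : Measurable w₂) :
    Measurable (bloomWeight p q w₁ w₂) :=
  (hw₁.div hw₂).pow_const _

theorem measure_sq_le_wmeas_bloomWeight (hp : 1 < p) (hq : 1 < q) (hm₁ : Measurable w₁)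
    (hm₂ : Measurable w₂) (h₁ : ∀ x, 0 < w₁ x) (h₂ : ∀ x, 0 < w₂ x) (S : Set X) :
    μ S ^ 2 ≤ wmeas μ (bloomWeight p q w₁ w₂) S ^ (1 / p + 1 / q.conjExponent) *
      (indicatorNorm μ p.conjExponent w₁⁻¹ S * indicatorNorm μ q w₂ S) := by
  have hp' := Real.HolderConjugate.conjExponent hp
  have hq' := Real.HolderConjugate.conjExponent hq
  have hpsum := hp'.inv_add_inv_eq_one
  have hqsum := hq'.inv_add_inv_eq_one
  have hs0 : 0 < 1 / p + 1 / q.conjExponent := add_pos hp'.one_div_pos hq'.symm.one_div_pos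
  set s := 1 / p + 1 / q.conjExponent with hs
  have hholder : μ S ≤ wmeas μ (bloomWeight p q w₁ w₂) S ^ (s / 2) *
      wmeas μ (fun y => w₁⁻¹ y ^ p.conjExponent) S ^ (1 / p.conjExponent / 2) *
        wmeas μ (fun y => w₂ y ^ q) S ^ (1 / q / 2) := by
    calc μ S = ∫⁻ y in S, ENNReal.ofReal (bloomWeight p q w₁ w₂ y) ^ (s / 2) *
          ENNReal.ofReal (w₁⁻¹ y ^ p.conjExponent) ^ (1 / p.conjExponent / 2) *
            ENNReal.ofReal (w₂ y ^ q) ^ (1 / q / 2) ∂μ := by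
          rw [← setLIntegral_one]
          exact lintegral_congr fun y => (bloomWeight_rpow_mul_rpow_mul_rpow_eq_one
            hp'.symm.ne_zero hq'.ne_zero hs0.ne' (h₁ y) (h₂ y)).symm
      _ ≤ _ := lintegral_rpow_mul_rpow_mul_rpow_le
          (measurable_bloomWeight hm₁ hm₂).ennreal_ofReal.aemeasurable
          (hm₁.inv.pow_const _).ennreal_ofReal.aemeasurable
          (hm₂.pow_const q).ennreal_ofReal.aemeasurable (half_pos hs0).le
          (half_pos hp'.symm.one_div_pos).le (half_pos hq'.one_div_pos).le
          (by rw [hs]; simp only [one_div]; linarith)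
  have hsq : ∀ (a : ℝ≥0∞) (t : ℝ), (a ^ (t / 2)) ^ 2 = a ^ t := fun a t => by
    rw [← ENNReal.rpow_mul_natCast]
    norm_num
  calc μ S ^ 2 ≤ _ := pow_le_pow_left' hholder 2
    _ = _ := by rw [mul_pow, mul_pow, hsq, hsq, hsq, mul_assoc, indicatorNorm, indicatorNorm]

theorem indicatorNorm_mul_indicatorNorm_mul_measure_le (hp : 1 < p) (hq : 1 < q)
    (hw₁ : IsWeight d μ w₁) (hw₂ : IsWeight d μ w₂) {x z : X} {r R : ℝ} (hr : 0 < r) (hR : 0 < R)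
    (h0 : μ (qball d x r) ≠ 0) (ht : μ (qball d z R) ≠ ∞)
    (hsub : qball d x r ⊆ qball d z R) (hS : S ⊆ qball d z R) :
    indicatorNorm μ p w₁ S * indicatorNorm μ q.conjExponent w₂⁻¹ (qball d x r) *
        μ (qball d x r) ≤
      appConst d μ p w₁ * appConst d μ q w₂ * μ (qball d z R) *
        wmeas μ (bloomWeight p q w₁ w₂) (qball d x r) ^ (1 / p + 1 / q.conjExponent) := by
  obtain ⟨hm₁, hpos₁, -⟩ := hw₁
  obtain ⟨hm₂, hpos₂, -⟩ := hw₂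
  have hfin : μ (qball d x r) ≠ ∞ := ne_top_of_le_ne_top ht (measure_mono hsub)
  have hpos : μ (qball d z R) ≠ 0 := fun hz => h0 (measure_mono_null hsub hz)
  have hν := measure_sq_le_wmeas_bloomWeight (μ := μ) hp hq hm₁ hm₂ hpos₁ hpos₂ (qball d x r)
  have hq_ap :=
    indicatorNorm_mul_indicatorNorm_inv_le hq (fun x => (hpos₂ x).le) x hr h0 hfin
  have hp_ap : indicatorNorm μ p w₁ S * indicatorNorm μ p.conjExponent w₁⁻¹ (qball d x r) ≤
      appConst d μ p w₁ * μ (qball d z R) :=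
    (mul_le_mul' (indicatorNorm_mono (one_pos.trans hp).le hS)
      (indicatorNorm_mono (Real.HolderConjugate.conjExponent hp).symm.nonneg hsub)).trans
        (indicatorNorm_mul_indicatorNorm_inv_le hp (fun x => (hpos₁ x).le) z hR hpos ht)
  set V := wmeas μ (bloomWeight p q w₁ w₂) (qball d x r) ^ (1 / p + 1 / q.conjExponent)
  set a := indicatorNorm μ p w₁ S
  set a' := indicatorNorm μ p.conjExponent w₁⁻¹ (qball d x r)
  set c := indicatorNorm μ q w₂ (qball d x r)
  set c' := indicatorNorm μ q.conjExponent w₂⁻¹ (qball d x r)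
  refine (ENNReal.mul_le_mul_iff_right h0 hfin).1 ?_
  calc μ (qball d x r) * (a * c' * μ (qball d x r)) = μ (qball d x r) ^ 2 * (a * c') := by ring
    _ ≤ V * (a' * c) * (a * c') := by gcongr
    _ = V * (a * a') * (c * c') := by ring
    _ ≤ V * (appConst d μ p w₁ * μ (qball d z R)) *
        (appConst d μ q w₂ * μ (qball d x r)) := by gcongr
    _ = _ := by ring

theorem wmeas_ne_zero (hw : Measurable w) (hpos : ∀ x, 0 < w x) (hS : μ S ≠ 0) :
    wmeas μ w S ≠ 0 := by
  have hsupp : Function.support (fun x => ENNReal.ofReal (w x)) = Set.univ :=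
    Set.eq_univ_of_forall fun x => by simpa using hpos x
  rw [wmeas, ← pos_iff_ne_zero, setLIntegral_pos_iff hw.ennreal_ofReal, hsupp, Set.univ_inter]
  exact pos_iff_ne_zero.2 hS

end Weights

/-! ### Weighted BMO -/

theorem one_div_add_one_div_conjExponent {p q : ℝ} (hq : 1 < q) :
    1 / p + 1 / q.conjExponent = 1 / p - 1 / q + 1 := by
  have := (Real.HolderConjugate.conjExponent hq).inv_add_inv_eq_one
  simp only [one_div]
  linarith

theorem bmoNorm_le [MeasurableSpace X] {d : X → X → ℝ} {μ : Measure X} {α : ℝ} {w : X → ℝ}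
    {b : X → ℂ} {c : ℝ≥0∞} (hw : ∀ x, ∀ r > 0, wmeas μ w (qball d x r) ≠ 0)
    (hb : ∀ x, ∀ r > 0, ∫⁻ y in qball d x r, ‖b y - ⨍ z in qball d x r, b z ∂μ‖ₑ ∂μ ≤
      c * wmeas μ w (qball d x r) ^ (α / upperDim d μ + 1)) :
    bmoNorm d μ α w b ≤ c := by
  refine iSup_le fun x => iSup_le fun r => iSup_le fun hr => ?_
  have hv := hw x r hr
  have hosc := hb x r hr
  set v := wmeas μ w (qball d x r)
  rcases eq_or_ne v ∞ with hv' | hv'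
  · simp [hv']
  set s := α / upperDim d μ
  rw [ENNReal.rpow_add _ _ hv hv', ENNReal.rpow_one] at hosc
  calc (v ^ s)⁻¹ * (v⁻¹ * ∫⁻ y in qball d x r, ‖b y - ⨍ z in qball d x r, b z ∂μ‖ₑ ∂μ)
      ≤ (v ^ s)⁻¹ * (v⁻¹ * (c * (v ^ s * v))) := by gcongr
    _ = c * ((v ^ s)⁻¹ * v ^ s) * (v⁻¹ * v) := by ring
    _ = c := by
        rw [ENNReal.inv_mul_cancel (by simp [hv, hv']) (by simp [hv, hv']),
          ENNReal.inv_mul_cancel hv hv', mul_one, mul_one]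

theorem le_mul_commutatorNorm [TopologicalSpace X] [MeasurableSpace X] {d : X → X → ℝ}
    {μ : Measure X} {p q : ℝ} {w₁ w₂ : X → ℝ} {b : X → ℂ} {T : Lp ℂ 2 μ →L[ℂ] Lp ℂ 2 μ}
    {C : ℝ≥0} {c : ℝ≥0∞} (hC : 0 < C)
    (h : ∀ Θ : ℝ≥0, CommutatorBound d p q w₁ w₂ b T Θ → c ≤ C * Θ) :
    c ≤ C * commutatorNorm d p q w₁ w₂ b T := by
  have hC' : (C : ℝ≥0∞) ≠ 0 := ENNReal.coe_ne_zero.2 hC.ne'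
  simp only [commutatorNorm, ENNReal.mul_iInf_of_ne hC' ENNReal.coe_ne_top]
  exact le_iInf fun Θ => le_iInf (h Θ)

/-! ### Testing the commutator -/

theorem enorm_mul_enorm_integral_le {𝕜 Y : Type*} [RCLike 𝕜] [MeasurableSpace Y] {ν : Measure Y}
    {k u : Y → 𝕜} {κ : 𝕜} {δ : ℝ≥0∞} (hu : Integrable u ν)
    (hku : Integrable (fun y => k y * u y) ν) (hk : ∀ᵐ y ∂ν, ‖k y - κ‖ₑ ≤ δ) :
    ‖κ‖ₑ * ‖∫ y, u y ∂ν‖ₑ ≤ ‖∫ y, k y * u y ∂ν‖ₑ + δ * ∫⁻ y, ‖u y‖ₑ ∂ν := by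
  have hsplit : κ * ∫ y, u y ∂ν = ∫ y, k y * u y ∂ν - ∫ y, (k y - κ) * u y ∂ν := by
    simp only [sub_mul]
    rw [integral_sub hku (hu.const_mul κ), integral_const_mul, sub_sub_cancel]
  have herror : ‖∫ y, (k y - κ) * u y ∂ν‖ₑ ≤ δ * ∫⁻ y, ‖u y‖ₑ ∂ν := by
    rw [← lintegral_const_mul'' δ hu.aestronglyMeasurable.enorm]
    refine (enorm_integral_le_lintegral_enorm _).trans (lintegral_mono_ae ?_)
    filter_upwards [hk] with y hy
    rw [enorm_mul]
    gcongr
  rw [← enorm_mul, hsplit]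
  exact enorm_sub_le.trans (by gcongr)

theorem IsTestPair.enorm_kernel_sub_le {d : X → X → ℝ} {K : X → X → ℂ} {x₀ y₀ x y : X}
    {r : ℝ} (ht : IsTestPair d K x₀ y₀ r) (hx : x ∈ qball d x₀ r) (hy : y ∈ qball d y₀ r) :
    ‖K x y - K x₀ y₀‖ₑ ≤ ‖K x₀ y₀‖ₑ * 6⁻¹ := by
  rw [← ofReal_norm, ← ofReal_norm (K x₀ y₀), ← div_eq_mul_inv, ← ENNReal.ofReal_ofNat 6,
    ← ENNReal.ofReal_div_of_pos (by norm_num)]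
  exact ENNReal.ofReal_le_ofReal (ht.norm_kernel_sub_le x hx y hy)

section LowerBound

variable [TopologicalSpace X] [MeasurableSpace X] [BorelSpace X] {d : X → X → ℝ} {μ : Measure X}
  {A₀ A₁ cK r : ℝ} {ω : ℝ → ℝ} {K : X → X → ℂ} {T : Lp ℂ 2 μ →L[ℂ] Lp ℂ 2 μ} {p q : ℝ}
  {w₁ w₂ : X → ℝ} {b f : X → ℂ} {Θ : ℝ≥0} {x₀ y₀ : X}

theorem IsHomogeneousType.memLinftyBs_indicator (h : IsHomogeneousType d μ A₀ A₁) (hr : 0 < r)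
    (hf : Measurable f) (hf1 : ∀ y, ‖f y‖ ≤ 1) (y₀ : X) :
    MemLinftyBs d ((qball d y₀ r).indicator f) := by
  have hA₀ : 0 < A₀ := h.quasi_pos
  refine ⟨hf.indicator (h.measurableSet_ball y₀ r),
    ⟨1, fun y => (norm_indicator_le_norm_self f y).trans (hf1 y)⟩,
    y₀, 2 * A₀ * r, by positivity, ?_⟩
  exact (closure_mono Set.support_indicator_subset).trans (h.closure_qball_subset y₀ hr)

theorem IsTestPair.memLp_top (ht : IsTestPair d K x₀ y₀ r) (h : IsHomogeneousType d μ A₀ A₁)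
    (hω : Tendsto ω (𝓝[>] 0) (𝓝 0)) (hK : IsCZKernel d μ A₀ cK ω K) (hr : 0 < r) {x : X}
    (hx : x ∈ qball d x₀ r) : MemLp (K x) ∞ (μ.restrict (qball d y₀ r)) := by
  have hS' : MeasurableSet (qball d y₀ r) := h.measurableSet_ball y₀ r
  have hsub : qball d y₀ r ⊆ {x}ᶜ := by
    rintro y hy rfl
    exact h.notMem_closure hr (ht.le_dist y hx) (subset_closure hy)
  refine memLp_top_of_bound
    (((hK.continuousOn h hω x).mono hsub).aemeasurable hS').aestronglyMeasurable
    (‖K x₀ y₀‖ + ‖K x₀ y₀‖ / 6) (ae_restrict_of_forall_mem hS' fun y hy => ?_)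
  exact (norm_le_norm_add_norm_sub' _ _).trans
    (by gcongr; exact ht.norm_kernel_sub_le x hx y hy)

theorem IsTestPair.ae_enorm_mul_le_commutator (ht : IsTestPair d K x₀ y₀ r)
    (h : IsHomogeneousType d μ A₀ A₁) (hω : Tendsto ω (𝓝[>] 0) (𝓝 0))
    (hK : IsCZKernel d μ A₀ cK ω K) (hT : HasKernel T K) (hb : MemL1loc d μ b) (hr : 0 < r)
    (hf : Measurable f) (hf1 : ∀ y, ‖f y‖ ≤ 1) :
    ∀ᵐ x ∂μ.restrict (qball d x₀ r),
      ‖K x₀ y₀‖ₑ * ‖∫ y in qball d y₀ r, (b x - b y) * f y ∂μ‖ₑ ≤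
        ‖commutator b T ((qball d y₀ r).indicator f) x‖ₑ +
          ‖K x₀ y₀‖ₑ * (6⁻¹ * ∫⁻ y in qball d y₀ r, ‖b x - b y‖ₑ ∂μ) := by
  set S' := qball d y₀ r
  have hS' : MeasurableSet S' := h.measurableSet_ball y₀ r
  have : IsFiniteMeasure (μ.restrict S') := isFiniteMeasure_restrict.2 (h.ball_lt_top y₀ r hr).ne
  have hg (s : ℝ≥0∞) : MemLp (S'.indicator f) s μ :=
    (memLp_indicator_iff_restrict hS').2 (.of_bound hf.aestronglyMeasurable 1 (.of_forall hf1))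
  have hbg : MemLp (fun y => b y * S'.indicator f y) 1 μ := by
    simp only [← Set.indicator_mul_right]
    exact (memLp_indicator_iff_restrict hS').2 (memLp_one_iff_integrable.2
      ((hb.2 y₀ r hr).mul_bdd hf.aestronglyMeasurable (.of_forall hf1)))
  filter_upwards [ae_restrict_of_ae (hT.commutator_eq_setIntegral hb.1 (hf.indicator hS') (hg 1)
    (hg 2) hbg Set.support_indicator_subset), ae_restrict_mem (h.measurableSet_ball x₀ r)]
    with x hcomm hx
  have hKx : MemLp (K x) ∞ (μ.restrict S') := ht.memLp_top h hω hK hr hx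
  have hu : IntegrableOn (fun y => (b x - b y) * f y) S' μ :=
    ((integrable_const (b x)).sub (hb.2 y₀ r hr)).mul_bdd hf.aestronglyMeasurable
      (.of_forall hf1)
  have hcongr : ∫ y in S', K x y * ((b x - b y) * S'.indicator f y) ∂μ =
      ∫ y in S', K x y * ((b x - b y) * f y) ∂μ :=
    setIntegral_congr_fun hS' fun y hy => by simp only [Set.indicator_of_mem hy]
  rw [hcomm (h.notMem_closure hr (ht.le_dist x hx)) hKx, hcongr]
  refine (enorm_mul_enorm_integral_le hu (hu.mul_of_top_right hKx)
    (ae_restrict_of_forall_mem hS' fun y hy => ht.enorm_kernel_sub_le hx hy)).trans ?_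
  rw [mul_assoc]
  gcongr with y
  rw [enorm_mul]
  exact mul_le_of_le_one_right zero_le (enorm_le_one_of_norm_le_one (hf1 y))

theorem IsTestPair.lintegral_enorm_integral_le (ht : IsTestPair d K x₀ y₀ r)
    (h : IsHomogeneousType d μ A₀ A₁) (hω : Tendsto ω (𝓝[>] 0) (𝓝 0))
    (hK : IsCZKernel d μ A₀ cK ω K) (hT : HasKernel T K) (hp : 0 < p) (hq : 1 < q)
    (hw₁ : ∀ x, 0 ≤ w₁ x) (hw₂ : Measurable w₂) (hw₂' : ∀ x, 0 < w₂ x) (hb : MemL1loc d μ b)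
    (hΘ : CommutatorBound d p q w₁ w₂ b T Θ) (hr : 0 < r) (hf : Measurable f)
    (hf1 : ∀ y, ‖f y‖ ≤ 1) :
    ∫⁻ x in qball d x₀ r, ‖∫ y in qball d y₀ r, (b x - b y) * f y ∂μ‖ₑ ∂μ ≤
      ‖K x₀ y₀‖ₑ⁻¹ * (Θ * indicatorNorm μ p w₁ (qball d y₀ r) *
        indicatorNorm μ q.conjExponent w₂⁻¹ (qball d x₀ r)) +
      6⁻¹ * ∫⁻ x in qball d x₀ r, ∫⁻ y in qball d y₀ r, ‖b x - b y‖ₑ ∂μ ∂μ := by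
  have : IsFiniteMeasure (μ.restrict (qball d y₀ r)) :=
    isFiniteMeasure_restrict.2 (h.ball_lt_top y₀ r hr).ne
  have hbm : Measurable b := hb.1
  have hF : Measurable fun x => ‖∫ y in qball d y₀ r, (b x - b y) * f y ∂μ‖ₑ := by
    refine (StronglyMeasurable.integral_prod_right'
      (f := fun z : X × X => (b z.1 - b z.2) * f z.2) ?_).measurable.enorm
    exact Measurable.stronglyMeasurable (by fun_prop)
  have hE : Measurable fun x => ∫⁻ y in qball d y₀ r, ‖b x - b y‖ₑ ∂μ :=
    Measurable.lintegral_prod_right' (f := fun z : X × X => ‖b z.1 - b z.2‖ₑ) (by fun_prop)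
  rw [← lintegral_const_mul _ hE]
  refine (setLIntegral_le_of_mul_le_enorm_add (Real.HolderConjugate.conjExponent hq) hw₂ hw₂' hF
    (hE.const_mul _) (enorm_ne_zero.2 ht.kernel_ne_zero) enorm_ne_top
    (ht.ae_enorm_mul_le_commutator h hω hK hT hb hr hf hf1)).trans ?_
  gcongr
  refine (hΘ _ (h.memLinftyBs_indicator hr hf hf1 y₀)).trans ?_
  gcongr
  exact wnorm_indicator_le_indicatorNorm hp hw₁ (h.measurableSet_ball y₀ r) hf1

theorem IsHomogeneousType.exists_engulfing_qball (h : IsHomogeneousType d μ A₀ A₁) (hr : 0 < r)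
    {a D : ℝ} (ha : 1 ≤ a) (hxy : d x₀ y₀ ≤ D * r) :
    ∃ R > 0, qball d x₀ (a * r) ⊆ qball d y₀ R ∧ qball d y₀ r ⊆ qball d y₀ R ∧
      ∀ z ∈ ({x₀, y₀} : Set X), μ (qball d y₀ R) ≤
        ENNReal.ofReal (growth A₁ (A₀ * (D + A₀ * (D + a)))) * μ (qball d z r) := by
  have hA₀ : 1 ≤ A₀ := h.one_le_quasi
  have hDr : 0 ≤ D * r := (h.dist_nonneg x₀ y₀).trans hxy
  have har : r ≤ a * r := le_mul_of_one_le_left hr.le ha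
  have hR : D * r + a * r ≤ A₀ * (D * r + a * r) := le_mul_of_one_le_left (by linarith) hA₀
  refine ⟨A₀ * (D * r + a * r), by linarith, h.qball_subset_qball ?_,
    qball_mono d y₀ (by linarith), fun z hz => h.measure_qball_le_growth_mul hr ?_⟩
  · rw [h.dist_symm y₀ x₀]
    gcongr
  · have hz : d z y₀ ≤ D * r := by
      rcases hz with rfl | rfl
      · exact hxy
      · rwa [(h.dist_eq_zero z z).2 rfl]
    calc A₀ * (d z y₀ + A₀ * (D * r + a * r)) ≤ A₀ * (D * r + A₀ * (D * r + a * r)) := by gcongr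
      _ = A₀ * (D + A₀ * (D + a)) * r := by ring

theorem IsTestPair.lintegral_enorm_sub_average_le (ht : IsTestPair d K x₀ y₀ r)
    (h : IsHomogeneousType d μ A₀ A₁) (hω : Tendsto ω (𝓝[>] 0) (𝓝 0))
    (hK : IsCZKernel d μ A₀ cK ω K) (hT : HasKernel T K) (hp : 1 < p) (hq : 1 < q)
    (hw₁ : IsWeight d μ w₁) (hw₂ : IsWeight d μ w₂) (hb : MemL1loc d μ b)
    (hΘ : CommutatorBound d p q w₁ w₂ b T Θ) (hr : 0 < r) {R : ℝ} {c M : ℝ≥0∞} (hR : 0 < R)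
    (hx : qball d x₀ r ⊆ qball d y₀ R) (hy : qball d y₀ r ⊆ qball d y₀ R)
    (hκ : ‖K x₀ y₀‖ₑ⁻¹ ≤ c * μ (qball d y₀ R))
    (hM : ∀ z ∈ ({x₀, y₀} : Set X), μ (qball d y₀ R) ≤ M * μ (qball d z r)) :
    ∫⁻ x in qball d x₀ r, ‖b x - ⨍ z in qball d x₀ r, b z ∂μ‖ₑ ∂μ ≤
      4 * c * M ^ 2 * (appConst d μ p w₁ * appConst d μ q w₂) * Θ *
        wmeas μ (bloomWeight p q w₁ w₂) (qball d x₀ r) ^ (1 / p + 1 / q.conjExponent) := by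
  have hpos (z : X) : μ (qball d z r) ≠ 0 := (h.measure_qball_pos z hr).ne'
  have hfin (z : X) : μ (qball d z r) ≠ ∞ := (h.ball_lt_top z r hr).ne
  have (z : X) : IsFiniteMeasure (μ.restrict (qball d z r)) := isFiniteMeasure_restrict.2 (hfin z)
  have hosc := measure_univ_mul_lintegral_enorm_sub_average_le (hb.2 x₀ r hr) (hb.2 y₀ r hr) hb.1
    fun f hf hf1 => ht.lintegral_enorm_integral_le h hω hK hT (zero_lt_one.trans hp) hq
      (fun x => (hw₁.2.1 x).le) hw₂.1 hw₂.2.1 hb hΘ hr hf hf1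
  have hweights := indicatorNorm_mul_indicatorNorm_mul_measure_le hp hq hw₁ hw₂ hr hR (hpos x₀)
    (h.ball_lt_top y₀ R hR).ne hx hy
  rw [Measure.restrict_apply_univ] at hosc
  set N := appConst d μ p w₁ * appConst d μ q w₂
  set V := wmeas μ (bloomWeight p q w₁ w₂) (qball d x₀ r) ^ (1 / p + 1 / q.conjExponent)
  set n₁ := indicatorNorm μ p w₁ (qball d y₀ r)
  set n₂ := indicatorNorm μ q.conjExponent w₂⁻¹ (qball d x₀ r)
  have hn : n₁ * n₂ ≤ N * M * V := by
    refine (ENNReal.mul_le_mul_iff_left (hpos x₀) (hfin x₀)).1 (hweights.trans ?_)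
    calc N * μ (qball d y₀ R) * V ≤ N * (M * μ (qball d x₀ r)) * V := by
          gcongr
          exact hM x₀ (by simp)
      _ = N * M * V * μ (qball d x₀ r) := by ring
  refine (ENNReal.mul_le_mul_iff_right (hpos y₀) (hfin y₀)).1 (hosc.trans ?_)
  calc 4 * (‖K x₀ y₀‖ₑ⁻¹ * (Θ * n₁ * n₂)) = 4 * (‖K x₀ y₀‖ₑ⁻¹ * (Θ * (n₁ * n₂))) := by
        rw [mul_assoc (Θ : ℝ≥0∞)]
    _ ≤ 4 * (c * (M * μ (qball d y₀ r)) * (Θ * (N * M * V))) := by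
        gcongr
        exact hκ.trans (by gcongr; exact hM y₀ (by simp))
    _ = μ (qball d y₀ r) * (4 * c * M ^ 2 * N * Θ * V) := by ring

/-- The factor by which the oscillation of `b` on a ball can exceed
`[w₁]_{A_{p,p}} [w₂]_{A_{q,q}} ‖[b, T]‖ ν(B)^{1/p + 1/q'}`, where `η` is the relative distance below
which the kernel is regular enough to be frozen. -/
def lowerBoundConst (A₀ A₁ c₀ Cbar η : ℝ) : ℝ :=
  4 * c₀ * growth A₁ (A₀ * (Cbar * (2 * A₀ / η) +
    A₀ * (Cbar * (2 * A₀ / η) + 2 * A₀ / η))) ^ 2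

theorem lintegral_enorm_sub_average_le_wmeas_bloomWeight (h : IsHomogeneousType d μ A₀ A₁)
    (hω : Tendsto ω (𝓝[>] 0) (𝓝 0)) (hK : IsCZKernel d μ A₀ cK ω K) {c₀ Cbar ε η : ℝ}
    (hnd : IsNondegenerate d μ c₀ Cbar K) (hT : HasKernel T K) (hp : 1 < p) (hq : 1 < q)
    (hw₁ : IsWeight d μ w₁) (hw₂ : IsWeight d μ w₂) (hb : MemL1loc d μ b)
    (hΘ : CommutatorBound d p q w₁ w₂ b T Θ) (hε : 0 ≤ ε) (hη₀ : 0 < η)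
    (hη : 2 * A₀ * η < 1) (hωε : ∀ t ∈ Set.Ioc 0 η, ω t ≤ ε)
    (hε' : 6 * c₀ * (1 + growth A₁ (2 * A₀ ^ 2 * (Cbar + 1))) * ε ≤ 1) (x₀ : X) (hr : 0 < r) :
    ∫⁻ x in qball d x₀ r, ‖b x - ⨍ z in qball d x₀ r, b z ∂μ‖ₑ ∂μ ≤
      ENNReal.ofReal (lowerBoundConst A₀ A₁ c₀ Cbar η) *
        (appConst d μ p w₁ * appConst d μ q w₂) * Θ *
        wmeas μ (bloomWeight p q w₁ w₂) (qball d x₀ r) ^ (1 / p + 1 / q.conjExponent) := by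
  have hc₀ : 0 < c₀ := hnd.1
  obtain ⟨y₀, ht, hxy, hκ⟩ := hnd.exists_isTestPair h hK hε hη₀ hη hωε hε' x₀ hr
  have ha : 1 ≤ 2 * A₀ / η := by
    rw [one_le_div hη₀]
    nlinarith [h.one_le_quasi]
  rw [← mul_assoc] at hxy
  obtain ⟨R, hR, hx, hy, hM⟩ := h.exists_engulfing_qball hr ha hxy
  have hκ' : ‖K x₀ y₀‖ₑ⁻¹ ≤ ENNReal.ofReal c₀ * μ (qball d y₀ R) := by
    rw [← ofReal_norm, ← ENNReal.ofReal_inv_of_pos (norm_pos_iff.2 ht.kernel_ne_zero)]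
    refine (ENNReal.ofReal_le_ofReal hκ).trans ?_
    rw [ENNReal.ofReal_mul hc₀.le,
      ofReal_measureReal (h.ball_lt_top x₀ _ (by have := h.quasi_pos; positivity)).ne]
    gcongr
  refine (ht.lintegral_enorm_sub_average_le h hω hK hT hp hq hw₁ hw₂ hb hΘ hr hR
    ((qball_mono d x₀ (le_mul_of_one_le_left hr.le ha)).trans hx) hy hκ' hM).trans_eq ?_
  rw [lowerBoundConst, ENNReal.ofReal_mul (by positivity), ENNReal.ofReal_mul (by norm_num),
    ENNReal.ofReal_pow (h.growth_pos _).le, ENNReal.ofReal_ofNat]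

theorem bmoNorm_bloomWeight_le (h : IsHomogeneousType d μ A₀ A₁)
    (hω : Tendsto ω (𝓝[>] 0) (𝓝 0)) (hK : IsCZKernel d μ A₀ cK ω K) {c₀ Cbar ε η α : ℝ}
    (hnd : IsNondegenerate d μ c₀ Cbar K) (hT : HasKernel T K) (hp : 1 < p) (hq : 1 < q)
    (hα : α / upperDim d μ = 1 / p - 1 / q) (hw₁ : IsWeight d μ w₁) (hw₂ : IsWeight d μ w₂)
    (hb : MemL1loc d μ b) (hΘ : CommutatorBound d p q w₁ w₂ b T Θ) (hε : 0 ≤ ε) (hη₀ : 0 < η)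
    (hη : 2 * A₀ * η < 1) (hωε : ∀ t ∈ Set.Ioc 0 η, ω t ≤ ε)
    (hε' : 6 * c₀ * (1 + growth A₁ (2 * A₀ ^ 2 * (Cbar + 1))) * ε ≤ 1) :
    bmoNorm d μ α (bloomWeight p q w₁ w₂) b ≤
      ENNReal.ofReal (lowerBoundConst A₀ A₁ c₀ Cbar η) *
        (appConst d μ p w₁ * appConst d μ q w₂) * Θ := by
  refine bmoNorm_le (fun x r hr => ?_) fun x r hr => ?_
  · exact wmeas_ne_zero (measurable_bloomWeight hw₁.1 hw₂.1) (bloomWeight_pos hw₁.2.1 hw₂.2.1)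
      (h.measure_qball_pos x hr).ne'
  · rw [hα, ← one_div_add_one_div_conjExponent hq]
    exact lintegral_enorm_sub_average_le_wmeas_bloomWeight h hω hK hnd hT hp hq hw₁ hw₂ hb hΘ hε
      hη₀ hη hωε hε' x hr

end LowerBound

end

end FracBloom

open FracBloom in
theorem theorem2_general (A₀ A₁ cK c₀ Cbar p q : ℝ) (N₁ N₂ : ℝ≥0) (ω : ℝ → ℝ)
    (hω : Tendsto ω (𝓝[>] 0) (𝓝 0)) (hp : 1 < p) (hq : 1 < q) :
    ∃ C : ℝ≥0, 0 < C ∧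
      ∀ (X : Type*) [TopologicalSpace X] [MeasurableSpace X] [BorelSpace X]
        (d : X → X → ℝ) (μ : Measure X), IsHomogeneousType d μ A₀ A₁ →
      ∀ K : X → X → ℂ, IsCZKernel d μ A₀ cK ω K → IsNondegenerate d μ c₀ Cbar K →
      ∀ T : Lp ℂ 2 μ →L[ℂ] Lp ℂ 2 μ, HasKernel T K →
      ∀ w₁ w₂ : X → ℝ, IsApp d μ p w₁ → appConst d μ p w₁ ≤ N₁ →
        IsApp d μ q w₂ → appConst d μ q w₂ ≤ N₂ →
      ∀ α : ℝ, α / upperDim d μ = 1 / p - 1 / q →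
      ∀ b : X → ℂ, MemL1loc d μ b → (∃ Θ : ℝ≥0, CommutatorBound d p q w₁ w₂ b T Θ) →
        MemBMO d μ α (bloomWeight p q w₁ w₂) b ∧
          bmoNorm d μ α (bloomWeight p q w₁ w₂) b ≤ C * commutatorNorm d p q w₁ w₂ b T := by
  obtain ⟨ε, hε, hε'⟩ := exists_pos_mul_lt one_pos
    (6 * c₀ * (1 + growth A₁ (2 * A₀ ^ 2 * (Cbar + 1))))
  obtain ⟨η, hη₀, hη, hωε⟩ := exists_pos_forall_le_of_tendsto hω hε (2 * A₀)
  set C : ℝ≥0 := (lowerBoundConst A₀ A₁ c₀ Cbar η).toNNReal * (N₁ * N₂) + 1 with hC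
  have hCpos : 0 < C := by positivity
  refine ⟨C, hCpos, ?_⟩
  intro X _ _ _ d μ h K hK hnd T hT w₁ w₂ hw₁ hN₁ hw₂ hN₂ α hα b hb ⟨Θ₀, hΘ₀⟩
  have hC' : ENNReal.ofReal (lowerBoundConst A₀ A₁ c₀ Cbar η) *
      (appConst d μ p w₁ * appConst d μ q w₂) ≤ C := by
    rw [hC, ENNReal.coe_add, ENNReal.coe_mul, ENNReal.coe_mul]
    exact le_add_right (by gcongr; rfl)
  have hbound (Θ : ℝ≥0) (hΘ : CommutatorBound d p q w₁ w₂ b T Θ) :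
      bmoNorm d μ α (bloomWeight p q w₁ w₂) b ≤ C * Θ :=
    (bmoNorm_bloomWeight_le h hω hK hnd hT hp hq hα hw₁.1 hw₂.1 hb hΘ hε.le hη₀ hη hωε
      hε'.le).trans (by gcongr)
  exact ⟨⟨hb, (hbound Θ₀ hΘ₀).trans_lt (ENNReal.mul_lt_top ENNReal.coe_lt_top
    ENNReal.coe_lt_top)⟩, le_mul_commutatorNorm hCpos hbound⟩

theorem theorem2 (A₀ A₁ cK c₀ Cbar p q : ℝ) (N₁ N₂ : ℝ≥0) (ω : ℝ → ℝ)
    (hω : FracBloom.IsModulus ω) (hDini : FracBloom.IsDini ω) (hp : 1 < p) (hpq : p ≤ q) :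
    ∃ C : ℝ≥0, 0 < C ∧
      ∀ (X : Type*) [TopologicalSpace X] [MeasurableSpace X] [BorelSpace X]
        (d : X → X → ℝ) (μ : Measure X), FracBloom.IsHomogeneousType d μ A₀ A₁ →
      ∀ K : X → X → ℂ, FracBloom.IsCZKernel d μ A₀ cK ω K →
        FracBloom.IsNondegenerate d μ c₀ Cbar K →
      ∀ T : Lp ℂ 2 μ →L[ℂ] Lp ℂ 2 μ, FracBloom.HasKernel T K →
      ∀ w₁ w₂ : X → ℝ, FracBloom.IsApp d μ p w₁ → FracBloom.appConst d μ p w₁ ≤ N₁ →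
        FracBloom.IsApp d μ q w₂ → FracBloom.appConst d μ q w₂ ≤ N₂ →
      ∀ α : ℝ, α / FracBloom.upperDim d μ = 1 / p - 1 / q →
      ∀ b : X → ℂ, FracBloom.MemL1loc d μ b →
        (∃ Θ : ℝ≥0, FracBloom.CommutatorBound d p q w₁ w₂ b T Θ) →
        FracBloom.MemBMO d μ α (FracBloom.bloomWeight p q w₁ w₂) b ∧
          FracBloom.bmoNorm d μ α (FracBloom.bloomWeight p q w₁ w₂) b ≤
            C * FracBloom.commutatorNorm d p q w₁ w₂ b T :=
  theorem2_general A₀ A₁ cK c₀ Cbar p q N₁ N₂ ω hω.tendsto_nhdsGT hp (hp.trans_le hpq)
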